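/- **Setting.** Let $K\ge 2$, $T\ge 3$, and let $G=([N],E)$ be a connected undirected graph. Let $W\in\mathbb R^{N\times N}$ be a gossip matrix on $G$: symmetric, doubly stochastic, with $W(i,j)>0$ only if $(i,j)\in E$ or $i=j$, and with second largest singular value $\sigma_2(W)<1$ ($\sigma_2(W)=0$ if $N=1$). Put $\rho=1-\sigma_2(W)$. An oblivious adversary fixes losses $\ell_t(i,k)\in[0,1]$ for $t\in[T]$, $i\in[N]$, $k\in[K]$; write $\bar\ell_t(k)=\frac1N\sum_{j=1}^N\ell_t(j,k)$ and $L^\star=\min_{k\in[K]}\sum_{t=1}^T\bar\ell_t(k)$. Set $$B=\left\lceil\frac{\ln\big((KT)^6\sqrt{14N}\big)}{(1-1/\sqrt2)\sqrt{1-\sigma_2(W)}}\right\rceil,\qquad \kappa=\frac1{1+\sqrt{1-\sigma_2(W)^2}} .$$ **Algorithm.** Split $[T]$ into consecutive blocks $\mathcal T_\tau=\{t\in[T]:(\tau-1)B<t\le\tau B\}$, $\tau=1,2,\dots$ (the last one may be shorter than $B$). In block $\tau$, agent $i$ obtains $\mathbf p'_\tau(i)\in\Delta(K)$ from a base learner (below),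 sets $\mathbf p_\tau(i)=(1-\frac1T)\mathbf p'_\tau(i)+\frac1{TK}\mathbf 1$, and in each round $t\in\mathcal T_\tau$ draws $A_t(i)\sim\mathbf p_\tau(i)$, independently over agents and over rounds of the block given the past; it forms $\hat\ell_t(i,k)=\frac{\ell_t(i,k)}{p_\tau(i,k)}\mathbb 1\{A_t(i)=k\}$. For $\tau\ge2$ the agents perform during block $\tau$ the $B$ accelerated gossip steps $$\mathbf z_\tau^{b+1}(i)=(1+\kappa)\sum_{j:\,j=i\text{ or }(i,j)\in E}W(i,j)\,\mathbf z_\tau^b(j)-\kappa\,\mathbf z_\tau^{b-1}(i),\qquad \mathbf z_\tau^{-1}(i)=\mathbf z_\tau^0(i)=\sum_{t\in\mathcal T_{\tau-1}}\hat{\boldsymbol\ell}_t(i),$$ and at the end of block $\tau$ the base learner of agent $i$ receives $\mathbf z_\tau^B(i)$ as its loss vector for block $\tau-1$. The base learner consists of two independent copies of FTRL, one used in the odd and one in the even blocks. The first output of each copy is the uniform distribution; after that, each copy outputs $\arg\min_{\mathbf q\in\Delta(K)}\{\langle \mathbf S,\mathbf q\rangle+\psi(\mathbf q)\}$, where $\mathbf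 S$ is the sum of the loss vectors received for the earlier blocks of that copy and $$\psi(\mathbf q)=\frac1\eta\sum_{k=1}^Kq(k)\log q(k)-\frac1\gamma\sum_{k=1}^K\log q(k)$$ ($\psi=+\infty$ if some $q(k)=0$), with $$\eta=\min\Big\{\frac1{4B},\sqrt{\frac{\log K}{BL^\star}}\Big\},\qquad \gamma=\min\Big\{\frac N{12},\sqrt{\frac{KN\log T}{L^\star}}\Big\}$$ ($\eta=\frac1{4B}$ and $\gamma=\frac N{12}$ if $L^\star=0$). **Theorem.** Let $\mathrm{Reg}_T=\max_{i\in[N]}\Big(\mathbb E\big[\sum_{t=1}^T\bar\ell_t(A_t(i))\big]-L^\star\Big)$, and let $$\Phi=\sqrt{BL^\star\log K}+\sqrt{\frac{KL^\star\log T}N}+B\log K+\frac{K\log T}N .$$ There are universal constants $C,C'>0$ and $m\in\mathbb N$ such that, for all $N,K,T,G,W,\ell$ as above, $\mathrm{Reg}_T\le C\,\Phi$ and $$\Phi\le C'\,\log^m(KNT)\left(\sqrt{\rho^{-1/2}L^\star}+\sqrt{\frac{KL^\star}N}+\rho^{-1/2}+\frac KN\right).$$ That is, $\mathrm{Reg}_T=O(\Phi)=\widetilde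 O\big(\sqrt{\rho^{-1/2}L^\star}+\sqrt{KL^\star/N}+\rho^{-1/2}+K/N\big)$, where $\widetilde O$ suppresses logarithmic factors in $T,N,K$. -/

import Mathlib

noncomputable section

namespace DistBandit

/-! ### Communication graph and accelerated gossip -/

/-- The closed neighbourhood `{j | (i, j) ∈ E} ∪ {i}` of the agent `i`. -/
def closedNbhd {N : ℕ} (G : SimpleGraph (Fin N)) (i : Fin N) : Finset (Fin N) :=
  open Classical in Finset.univ.filter fun j => G.Adj i j ∨ j = i

/-- A gossip matrix: symmetric, doubly stochastic (with nonnegative entries), and supported on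
the edges of `G` and the diagonal. -/
structure IsGossipMatrix {N : ℕ} (G : SimpleGraph (Fin N)) (W : Matrix (Fin N) (Fin N) ℝ) :
    Prop where
  isSymm : W.IsSymm
  mem_doublyStochastic : W ∈ doublyStochastic ℝ (Fin N)
  supported : ∀ i j, 0 < W i j → G.Adj i j ∨ i = j

/-- The second largest singular value of `W`. Mathlib indexes the decreasing sequence of singular
values from zero and pads it with zeros, so that this is `0` for a `1 × 1` matrix. -/
def sigma2 {N : ℕ} (W : Matrix (Fin N) (Fin N) ℝ) : ℝ :=
  (Matrix.toEuclideanLin W).singularValues 1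

/-- The spectral gap `ρ(W) = 1 - σ₂(W)`. -/
def spectralGap {N : ℕ} (W : Matrix (Fin N) (Fin N) ℝ) : ℝ := 1 - sigma2 W

/-- The mixing coefficient `κ = 1 / (1 + √(1 - σ₂(W)²))`. -/
def mixing {N : ℕ} (W : Matrix (Fin N) (Fin N) ℝ) : ℝ := 1 / (1 + √(1 - sigma2 W ^ 2))

/-- The block length `B = ⌈ln((KT)⁶ √(14 N)) / ((1 - 1/√2) √(1 - σ₂(W)))⌉`. -/
def blockLength {N : ℕ} (K T : ℕ) (W : Matrix (Fin N) (Fin N) ℝ) : ℕ :=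
  ⌈Real.log (((K : ℝ) * T) ^ 6 * √(14 * N)) / ((1 - 1 / √2) * √(1 - sigma2 W))⌉₊

/-- The pair `(x^{b-1}, x^b)` after `b` rounds of accelerated gossip started at
`x^{-1} = x^0 = x`, where `x^{b+1}(i) = (1+κ) ∑_{j ∈ 𝒩(i)} W(i,j) x^b(j) - κ x^{b-1}(i)`. -/
def gossipPair {N K : ℕ} (G : SimpleGraph (Fin N)) (W : Matrix (Fin N) (Fin N) ℝ) (κ : ℝ)
    (x : Fin N → Fin K → ℝ) : ℕ → (Fin N → Fin K → ℝ) × (Fin N → Fin K → ℝ)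
  | 0 => (x, x)
  | b + 1 =>
    let y := gossipPair G W κ x b
    (y.2, fun i k => (1 + κ) * (∑ j ∈ closedNbhd G i, W i j * y.2 j k) - κ * y.1 i k)

/-- The vectors `x^b(i)` after `b` rounds of accelerated gossip. -/
def gossip {N K : ℕ} (G : SimpleGraph (Fin N)) (W : Matrix (Fin N) (Fin N) ℝ) (κ : ℝ)
    (x : Fin N → Fin K → ℝ) (b : ℕ) : Fin N → Fin K → ℝ :=
  (gossipPair G W κ x b).2

/-! ### The base learner and the reduction from delayed feedback -/

/-- A deterministic online learner over `K` actions: from the sequence of loss vectors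
`z₁, z₂, …` it produces its outputs `q₁, q₂, …` (indices start at `1`). -/
abbrev Learner (K : ℕ) := (ℕ → Fin K → ℝ) → ℕ → Fin K → ℝ

/-- `argmin_{q ∈ Δ(K)} {⟨S, q⟩ + ψ(q)}` for an extended-real-valued regularizer `ψ`
(some minimizer; an arbitrary vector if there is none). -/
def regArgmin {K : ℕ} (ψ : (Fin K → ℝ) → EReal) (S : Fin K → ℝ) : Fin K → ℝ :=
  Classical.epsilon fun q =>
    q ∈ stdSimplex ℝ (Fin K) ∧
      IsMinOn (fun q' => ((∑ k, S k * q' k : ℝ) : EReal) + ψ q') (stdSimplex ℝ (Fin K)) q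

/-- Follow the regularized leader: `q₁` is uniform and
`q_{s+1} = argmin_{q ∈ Δ(K)} {∑_{r ≤ s} ⟨z_r, q⟩ + ψ_s(q)}`. -/
def ftrl {K : ℕ} (ψ : ℕ → (Fin K → ℝ) → EReal) : Learner K := fun z s =>
  if s ≤ 1 then fun _ => 1 / (K : ℝ)
  else regArgmin (ψ (s - 1)) (fun k => ∑ r ∈ Finset.Icc 1 (s - 1), z r k)

/-- The hybrid regularizer `(1/η) ∑ q(k) log q(k) - (1/γ) ∑ log q(k)`, with value `+∞` where some
coordinate is not positive. -/
def hybridReg {K : ℕ} (η γ : ℝ) (q : Fin K → ℝ) : EReal :=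
  open Classical in
  if ∀ k, 0 < q k then
    ((1 / η * ∑ k, q k * Real.log (q k) - 1 / γ * ∑ k, Real.log (q k) : ℝ) : EReal)
  else ⊤

/-- The reduction from one-block-delayed feedback to no delay, with two copies of the base learner:
in block `τ` the copy `τ mod 2` is queried for its output number `⌊(τ+1)/2⌋`. Here `Z σ` is the
vector delivered at the end of block `σ ≥ 2`, which is the feedback for block `σ - 1`. The `s`-th
block of the copy `r = τ mod 2` is the block `2 s - r`, whose feedback is `Z (2 s - r + 1)`. -/
def delayed {K : ℕ} (base : Learner K) : Learner K := fun Z τ =>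
  base (fun s => Z (2 * s - τ % 2 + 1)) ((τ + 1) / 2)

/-! ### The distributed algorithm

Rounds are indexed by `Fin T`, so that round number `t + 1` of the text is `t : Fin T`. Blocks are
numbered from `1`. If `B` does not divide `T`, then the last block is shorter. -/

/-- The number of the block containing the round `t`. -/
def blockOf (B t : ℕ) : ℕ := t / B + 1

/-- The sum over the rounds of block `τ` of the importance-weighted loss estimates
`ℓ_t(i,k) / p(i,k) · 𝟙{A_t(i) = k}`, if `p` is played in this block and the actions are `a`. -/
def blockEstimate {N K T : ℕ} (B : ℕ) (ℓ : Fin T → Fin N → Fin K → ℝ)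
    (a : Fin T → Fin N → Fin K) (τ : ℕ) (p : Fin N → Fin K → ℝ) : Fin N → Fin K → ℝ :=
  fun i k => ∑ t ∈ (Finset.univ : Finset (Fin T)).filter (fun t => blockOf B t.val = τ),
    if a t i = k then ℓ t i k / p i k else 0

/-- The distributions `p_τ(i)` played in block `τ` by the agents, as a function of the realized
actions `a`. Agent `i` runs its own copy of `A`; the vector `z_σ^B(i)`, the result of `B` gossip
rounds on the estimates of block `σ - 1`, is available to it in the blocks `τ > σ`
(not yet available vectors are replaced by `0`). Its output `p'_τ(i)` is mixed with the uniform
distribution: `p_τ(i) = (1 - 1/T) p'_τ(i) + (1/T) (1/K) 𝟏`. -/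
def policy {N K T : ℕ} (G : SimpleGraph (Fin N)) (W : Matrix (Fin N) (Fin N) ℝ) (κ : ℝ) (B : ℕ)
    (A : Learner K) (ℓ : Fin T → Fin N → Fin K → ℝ) (a : Fin T → Fin N → Fin K)
    (τ : ℕ) : Fin N → Fin K → ℝ :=
  let z : ℕ → Fin N → Fin K → ℝ := fun σ =>
    if h : 2 ≤ σ ∧ σ < τ then
      gossip G W κ (blockEstimate B ℓ a (σ - 1) (policy G W κ B A ℓ a (σ - 1))) B
    else 0
  fun i k => (1 - 1 / (T : ℝ)) * A (fun σ => z σ i) τ k + 1 / (T : ℝ) * (1 / (K : ℝ))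
termination_by τ
decreasing_by omega

/-- The probability that the actions of all agents in all rounds are `a`: given the past, the
actions `A_t(i)` of round `t` are drawn independently from the `p_τ(i)`, `τ` the block of `t`. -/
def trajProb {N K T : ℕ} (G : SimpleGraph (Fin N)) (W : Matrix (Fin N) (Fin N) ℝ) (κ : ℝ) (B : ℕ)
    (A : Learner K) (ℓ : Fin T → Fin N → Fin K → ℝ) (a : Fin T → Fin N → Fin K) : ℝ :=
  ∏ t : Fin T, ∏ i : Fin N, policy G W κ B A ℓ a (blockOf B t) i (a t i)

/-- The global average loss `(1/N) ∑_j ℓ_t(j,k)`. -/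
def avgLoss {N K T : ℕ} (ℓ : Fin T → Fin N → Fin K → ℝ) (t : Fin T) (k : Fin K) : ℝ :=
  1 / (N : ℝ) * ∑ j : Fin N, ℓ t j k

/-- `L⋆ = min_k ∑_t (1/N) ∑_j ℓ_t(j,k)`. -/
def bestLoss {N K T : ℕ} (ℓ : Fin T → Fin N → Fin K → ℝ) : ℝ :=
  ⨅ k : Fin K, ∑ t : Fin T, avgLoss ℓ t k

/-- `Reg_T(i) = 𝔼[∑_t ℓ̄_t(A_t(i))] - min_k ∑_t ℓ̄_t(k)`. -/
def agentRegret {N K T : ℕ} (G : SimpleGraph (Fin N)) (W : Matrix (Fin N) (Fin N) ℝ) (κ : ℝ)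
    (B : ℕ) (A : Learner K) (ℓ : Fin T → Fin N → Fin K → ℝ) (i : Fin N) : ℝ :=
  (∑ a : Fin T → Fin N → Fin K, trajProb G W κ B A ℓ a * ∑ t : Fin T, avgLoss ℓ t (a t i))
    - bestLoss ℓ

/-- `Reg_T = max_i Reg_T(i)`. -/
def regret {N K T : ℕ} (G : SimpleGraph (Fin N)) (W : Matrix (Fin N) (Fin N) ℝ) (κ : ℝ)
    (B : ℕ) (A : Learner K) (ℓ : Fin T → Fin N → Fin K → ℝ) : ℝ :=
  ⨆ i : Fin N, agentRegret G W κ B A ℓ i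

/-! ### The small-loss tuning -/

/-- `η = min {1/(4B), √(log K / (B L))}`, which is `1/(4B)` for `L = 0`. -/
def etaSL (K B : ℕ) (L : ℝ) : ℝ :=
  open Classical in
  if L = 0 then 1 / (4 * (B : ℝ)) else min (1 / (4 * (B : ℝ))) √(Real.log K / (B * L))

/-- `γ = min {N/12, √(K N log T / L)}`, which is `N/12` for `L = 0`. -/
def gammaSL (N K T : ℕ) (L : ℝ) : ℝ :=
  open Classical in
  if L = 0 then (N : ℝ) / 12 else min ((N : ℝ) / 12) √((K : ℝ) * N * Real.log T / L)

/-- The delayed learner with two copies of FTRL with the hybrid regularizer tuned with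
`L = L⋆`. -/
def smallLossLearner (N K T B : ℕ) (L : ℝ) : Learner K :=
  delayed (ftrl fun _ => hybridReg (etaSL K B L) (gammaSL N K T L))

end DistBandit

end

-- Every agent ends up running FTRL on almost the same data, namely the network mean of the
-- importance-weighted estimates of a block, and that mean has a variance smaller by a factor `N`
-- than a single estimate.
--
-- Gossip. On the orthogonal complement of the constants, `W` has norm `σ₂ < 1`. The deviation from
-- the mean obeys a momentum recurrence whose quadratic energy is multiplied by exactly `κ` per
-- step, so it decays like `b √κ ^ b` (`norm_le_of_momentum_recurrence`). Since `√κ ≤ exp (-(1 -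
-- 1/√2) √(1 - σ₂))`, one block of length `B` brings the error down to `1/(K⁵T³)`. This is so small
-- that FTRL outputs of different agents differ by at most `1/(TK)`, which the uniform exploration
-- absorbs: the distribution played by any agent is at least `2/3` of the learner output of any
-- other (`policy_ge_learnerOut`).
--
-- FTRL. Write the observed mean as `c + (y - c)`, where `c ≤ B` is the true average loss of the
-- block and `y - c` is centred noise. The entropy part of the regularizer pays `η q c² ≤ η B q c`
-- for the first summand, and the log-barrier part pays `γ q² (y - c)²` for the second
-- (`stability_coord_le`). Because estimates of different agents and rounds in a block are
-- uncorrelated and the distributions are comparable, the expectation of the latter is of order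
-- `(γ/N) q c`. Both stability terms are thus small multiples of the learner's own expected loss, so
-- they can be absorbed, which replaces that loss by `L⋆` (`agentRegret_le`). Optimizing `η` and `γ`
-- against the penalty `log K / η + K log T / γ` gives `Φ`.
--
-- Feedback for a block arrives one block late; separating odd and even blocks removes the delay at
-- the cost of a factor two in the penalty. If `B > T`, the gossip estimate is not used: the regret
-- is at most `T`, already below a multiple of `B log K`.

noncomputable section

namespace DistBandit

/-! ### Accelerated gossip -/

section Contraction

open Module InnerProductSpace

variable {E : Type*} [NormedAddCommGroup E] [InnerProductSpace ℝ E]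

/-- A symmetric operator with second singular value `σ < 1` and a fixed vector `e` contracts the
orthogonal complement of `e` by the factor `σ`. -/
theorem norm_apply_le_singularValues_one [FiniteDimensional ℝ E] {A : E →ₗ[ℝ] E}
    (hA : A.IsSymmetric) {e : E} (he : e ≠ 0) (hAe : A e = e) (hσ : A.singularValues 1 < 1)
    {v : E} (hv : ⟪e, v⟫_ℝ = 0) : ‖A v‖ ≤ A.singularValues 1 * ‖v‖ := by
  have hS := A.isSymmetric_adjoint_comp_self
  set b := hS.eigenvectorBasis rfl with hb
  have hσ0 := A.singularValues_nonneg 1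
  have hSe : (LinearMap.adjoint A ∘ₗ A) e = e := by
    have : LinearMap.adjoint A = A := (LinearMap.isSymmetric_iff_isSelfAdjoint A).1 hA
    simp [this, hAe]
  have hlam : ∀ j : Fin (finrank ℝ E), 1 ≤ j.val →
      hS.eigenvalues rfl j ≤ A.singularValues 1 ^ 2 := by
    intro j hj
    rw [← A.sq_singularValues_fin rfl j]
    exact pow_le_pow_left₀ (A.singularValues_nonneg _) (A.singularValues_antitone hj) 2
  have hbS : ∀ (w : E) j, ⟪b j, (LinearMap.adjoint A ∘ₗ A) w⟫_ℝ =
      hS.eigenvalues rfl j * ⟪b j, w⟫_ℝ := by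
    intro w j
    rw [← hS, hb, hS.apply_eigenvectorBasis rfl j]
    simp [inner_smul_left]
  -- `e` is an eigenvector of `A* A` with eigenvalue `1`, while the eigenvalues of index at least
  -- one are at most `σ² < 1`. Hence `e` is a multiple of the eigenvector of index zero, and `v ⟂ e`
  -- has no component along it.
  have hbe : ∀ j : Fin (finrank ℝ E), 1 ≤ j.val → ⟪b j, e⟫_ℝ = 0 := by
    intro j hj
    have h1 := hbS e j
    rw [hSe] at h1
    have h2 := hlam j hj
    have h3 : (1 - hS.eigenvalues rfl j) * ⟪b j, e⟫_ℝ = 0 := by linarith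
    have h4 : A.singularValues 1 ^ 2 < 1 := by nlinarith
    rcases mul_eq_zero.1 h3 with h | h
    · linarith
    · exact h
  have hb0 : ∀ j : Fin (finrank ℝ E), j.val = 0 → ⟪b j, v⟫_ℝ = 0 := by
    intro j hj
    have h1 := b.sum_inner_mul_inner e v
    rw [hv, Finset.sum_eq_single j] at h1
    · rcases mul_eq_zero.1 h1 with h | h
      · exfalso
        apply he
        have h2 : ∀ i, ⟪b i, e⟫_ℝ = 0 := by
          intro i
          by_cases hi : i = j
          · rw [hi, real_inner_comm]; exact h
          · apply hbe
            have : i.val ≠ j.val := fun h => hi (Fin.ext h)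
            omega
        have h3 := b.sum_inner_mul_inner e e
        simp only [h2, mul_zero, Finset.sum_const_zero] at h3
        exact inner_self_eq_zero.1 h3.symm
      · exact h
    · intro i _ hi
      have : i.val ≠ j.val := fun h => hi (Fin.ext h)
      rw [real_inner_comm, hbe i (by omega), zero_mul]
    · simp
  have h1 : ‖A v‖ ^ 2 = ∑ j, hS.eigenvalues rfl j * ⟪b j, v⟫_ℝ ^ 2 := by
    rw [← real_inner_self_eq_norm_sq, ← LinearMap.adjoint_inner_right,
      ← LinearMap.comp_apply, ← b.sum_inner_mul_inner]
    refine Finset.sum_congr rfl fun j _ => ?_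
    rw [hbS, real_inner_comm]; ring
  have h2 : ‖v‖ ^ 2 = ∑ j, ⟪b j, v⟫_ℝ ^ 2 := by
    rw [← real_inner_self_eq_norm_sq, ← b.sum_inner_mul_inner]
    refine Finset.sum_congr rfl fun j _ => ?_
    rw [real_inner_comm]; ring
  refine le_of_sq_le_sq ?_ (by positivity)
  rw [h1, mul_pow, h2, Finset.mul_sum]
  refine Finset.sum_le_sum fun j _ => ?_
  rcases Nat.eq_zero_or_pos j.val with h | h
  · simp [hb0 j h]
  · exact mul_le_mul_of_nonneg_right (hlam j h) (sq_nonneg _)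

/-- The energy of a second-order recurrence with a symmetric operator decays geometrically. -/
theorem norm_le_of_momentum_recurrence {A : E →ₗ[ℝ] E} (hA : A.IsSymmetric) {κ σ : ℝ}
    (hκ0 : 0 ≤ κ) (hκ1 : κ ≤ 1) (hσ1 : σ ≤ 1)
    (hκσ : ((1 + κ) / 2) ^ 2 * σ ^ 2 ≤ κ)
    {d : ℕ → E} (hd : ∀ b, d (b + 2) = (1 + κ) • A (d (b + 1)) - κ • d b)
    (h01 : d 1 = d 0) (hAd : ∀ b, ‖A (d b)‖ ≤ σ * ‖d b‖) (b : ℕ) :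
    ‖d (b + 1)‖ ≤ √κ ^ b * ((1 + 2 * b) * ‖d 0‖) := by
  -- This form is the invariant of the recurrence: substituting for `d (b + 2)` and using the
  -- symmetry of `A` gives `Q (b + 1) = κ Q b` exactly.
  set Q : ℕ → ℝ := fun b => ‖d (b + 1)‖ ^ 2 - (1 + κ) * ⟪A (d (b + 1)), d b⟫_ℝ + κ * ‖d b‖ ^ 2
    with hQ
  have hQs : ∀ b, Q b = κ ^ b * Q 0 := by
    intro b
    induction b with
    | zero => simp
    | succ b ih =>
      have : Q (b + 1) = κ * Q b := by
        simp only [hQ]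
        have e1 : ⟪A (d (b + 1 + 1)), d (b + 1)⟫_ℝ = ⟪d (b + 2), A (d (b + 1))⟫_ℝ := hA _ _
        rw [e1, ← real_inner_self_eq_norm_sq, ← real_inner_self_eq_norm_sq,
          ← real_inner_self_eq_norm_sq]
        rw [show b + 1 + 1 = b + 2 from rfl, hd b]
        simp only [inner_sub_left, inner_sub_right, inner_smul_left, inner_smul_right,
          RCLike.conj_to_real]
        rw [real_inner_comm (A (d (b + 1))) (d b)]
        ring
      rw [this, ih, pow_succ]; ring
  have hQ0 : Q 0 ≤ (2 * ‖d 0‖) ^ 2 := by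
    simp only [hQ, zero_add, h01]
    have h1 : |⟪A (d 0), d 0⟫_ℝ| ≤ ‖A (d 0)‖ * ‖d 0‖ := abs_real_inner_le_norm _ _
    have h2 : ‖A (d 0)‖ * ‖d 0‖ ≤ ‖d 0‖ ^ 2 := by
      nlinarith [hAd 0, norm_nonneg (d 0), mul_nonneg (norm_nonneg (d 0)) (norm_nonneg (d 0))]
    have h3 := (abs_le.1 h1).1
    nlinarith [sq_nonneg ‖d 0‖]
  -- Completing the square; `hκσ` makes the remainder nonnegative.
  have hlow : ∀ b, ‖d (b + 1) - ((1 + κ) / 2) • A (d b)‖ ^ 2 ≤ Q b := by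
    intro b
    have h1 : Q b = ‖d (b + 1) - ((1 + κ) / 2) • A (d b)‖ ^ 2 +
        (κ * ‖d b‖ ^ 2 - ((1 + κ) / 2) ^ 2 * ‖A (d b)‖ ^ 2) := by
      simp only [hQ]
      rw [norm_sub_sq_real, inner_smul_right, norm_smul, mul_pow, Real.norm_eq_abs, sq_abs, hA]
      ring
    have h2 : ‖A (d b)‖ ^ 2 ≤ σ ^ 2 * ‖d b‖ ^ 2 := by
      rw [← mul_pow]; exact pow_le_pow_left₀ (norm_nonneg _) (hAd b) 2
    nlinarith [mul_le_mul_of_nonneg_left h2 (sq_nonneg ((1 + κ) / 2)),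
      mul_le_mul_of_nonneg_right hκσ (sq_nonneg ‖d b‖)]
  have hr : √κ ^ 2 = κ := Real.sq_sqrt hκ0
  have hr0 := Real.sqrt_nonneg κ
  -- The energy bound makes the second-order recurrence a first-order one with ratio `√κ` and
  -- forcing of size `√κ ^ b`; this resonance produces the factor `1 + 2 b`.
  have hstep : ∀ b, ‖d (b + 1)‖ ≤ √κ * ‖d b‖ + √κ ^ b * (2 * ‖d 0‖) := by
    intro b
    have h1 : ‖d (b + 1) - ((1 + κ) / 2) • A (d b)‖ ≤ √κ ^ b * (2 * ‖d 0‖) := by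
      refine le_of_sq_le_sq ((hlow b).trans ?_) (by positivity)
      rw [hQs, mul_pow, ← pow_mul, mul_comm b 2, pow_mul, hr]
      exact mul_le_mul_of_nonneg_left hQ0 (by positivity)
    have h2 : ‖((1 + κ) / 2) • A (d b)‖ ≤ √κ * ‖d b‖ := by
      refine le_of_sq_le_sq ?_ (by positivity)
      rw [norm_smul, mul_pow, mul_pow, hr, Real.norm_eq_abs, sq_abs]
      have h2 : ‖A (d b)‖ ^ 2 ≤ σ ^ 2 * ‖d b‖ ^ 2 := by
        rw [← mul_pow]; exact pow_le_pow_left₀ (norm_nonneg _) (hAd b) 2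
      nlinarith [mul_le_mul_of_nonneg_left h2 (sq_nonneg ((1 + κ) / 2)),
        mul_le_mul_of_nonneg_right hκσ (sq_nonneg ‖d b‖)]
    calc ‖d (b + 1)‖ = ‖((1 + κ) / 2) • A (d b) + (d (b + 1) - ((1 + κ) / 2) • A (d b))‖ := by
          congr 1; abel
      _ ≤ _ := norm_add_le _ _
      _ ≤ _ := add_le_add h2 h1
  induction b with
  | zero => simp [h01]
  | succ b ih =>
    calc ‖d (b + 1 + 1)‖ ≤ √κ * ‖d (b + 1)‖ + √κ ^ (b + 1) * (2 * ‖d 0‖) := hstep (b + 1)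
      _ ≤ √κ * (√κ ^ b * ((1 + 2 * b) * ‖d 0‖)) + √κ ^ (b + 1) * (2 * ‖d 0‖) := by gcongr
      _ = _ := by push_cast; ring

end Contraction

/-! ### Convergence of accelerated gossip to the network mean -/

section Gossip

variable {N K : ℕ} {G : SimpleGraph (Fin N)} {W : Matrix (Fin N) (Fin N) ℝ}

theorem sigma2_nonneg (W : Matrix (Fin N) (Fin N) ℝ) : 0 ≤ sigma2 W :=
  LinearMap.singularValues_nonneg _ _

theorem sum_closedNbhd (hW : IsGossipMatrix G W) (i : Fin N) (x : Fin N → ℝ) :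
    ∑ j ∈ closedNbhd G i, W i j * x j = ∑ j, W i j * x j := by
  classical
  refine Finset.sum_subset (Finset.subset_univ _) fun j _ hj => ?_
  have h0 : W i j = 0 := by
    refine le_antisymm (not_lt.1 fun h => hj ?_) (nonneg_of_mem_doublyStochastic hW.2)
    rcases hW.supported i j h with h | h
    · simp [closedNbhd, h]
    · simp [closedNbhd, h]
  simp [h0]

theorem gossipPair_succ_fst (κ : ℝ) (x : Fin N → Fin K → ℝ) (b : ℕ) :
    (gossipPair G W κ x (b + 1)).1 = gossip G W κ x b := rfl

theorem gossipPair_zero_fst (κ : ℝ) (x : Fin N → Fin K → ℝ) :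
    (gossipPair G W κ x 0).1 = x := rfl

theorem gossip_succ (hW : IsGossipMatrix G W) (κ : ℝ) (x : Fin N → Fin K → ℝ) (b : ℕ)
    (i : Fin N) (k : Fin K) : gossip G W κ x (b + 1) i k =
      (1 + κ) * (∑ j, W i j * gossip G W κ x b j k) - κ * (gossipPair G W κ x b).1 i k := by
  rw [← sum_closedNbhd hW i fun j => gossip G W κ x b j k]
  rfl

/-- Column sums equal one and `(1 + κ) - κ = 1`, so the total is conserved. The recurrence has order
two, so both components of the pair are carried through the induction. -/
theorem sum_gossipPair (hW : IsGossipMatrix G W) (κ : ℝ) (x : Fin N → Fin K → ℝ) (b : ℕ)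
    (k : Fin K) : ∑ i, (gossipPair G W κ x b).1 i k = ∑ i, x i k ∧
      ∑ i, gossip G W κ x b i k = ∑ i, x i k := by
  induction b with
  | zero => exact ⟨rfl, rfl⟩
  | succ b ih =>
    refine ⟨ih.2, ?_⟩
    simp only [gossip_succ hW, Finset.sum_sub_distrib, ← Finset.mul_sum, ih.1]
    rw [Finset.sum_comm]
    simp only [← Finset.sum_mul, sum_col_of_mem_doublyStochastic hW.2, one_mul, ih.2]
    ring

/-- The deviation of gossip iterates from the mean, for the coordinate `k`; the index is shifted by
one, so that the index `0` stands for the vector before the first one. -/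
def gossipDev (G : SimpleGraph (Fin N)) (W : Matrix (Fin N) (Fin N) ℝ) (κ : ℝ)
    (x : Fin N → Fin K → ℝ) (k : Fin K) (b : ℕ) : EuclideanSpace ℝ (Fin N) :=
  WithLp.toLp 2 fun i => (gossipPair G W κ x b).1 i k - (∑ j, x j k) / N

/-- With `s = √(1 - σ²)`, the convex function `1/√(1+s)` lies below its chord `1 - (1 - 1/√2) s` on
`[0, 1]`; then `s ≥ √(1 - σ)` and `1 - x ≤ exp (-x)`. This is the source of the constant `1 - 1/√2`
in the block length. The chord inequality is proved by an explicit factorization with `c² = 1/2`. -/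
theorem sqrt_mixing_le {σ : ℝ} (hσ0 : 0 ≤ σ) (hσ1 : σ < 1) :
    √(1 / (1 + √(1 - σ ^ 2))) ≤ Real.exp (-((1 - 1 / √2) * √(1 - σ))) := by
  set s := √(1 - σ ^ 2) with hs
  have hs0 : 0 ≤ s := Real.sqrt_nonneg _
  have hs2 : s ^ 2 = 1 - σ ^ 2 := Real.sq_sqrt (by nlinarith)
  have hs1 : s ≤ 1 := by nlinarith [sq_nonneg σ]
  have hr : √(1 - σ) ≤ s := Real.sqrt_le_sqrt (by nlinarith)
  set c := 1 / √2 with hc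
  have hc0 : 0 < c := by positivity
  have hc2 : c ^ 2 = 1 / 2 := by rw [hc, div_pow, Real.sq_sqrt (by norm_num)]; norm_num
  have hc1 : c ≤ 1 := by nlinarith
  have h1 : √(1 / (1 + s)) ≤ 1 - (1 - c) * s := by
    have hpos : 0 ≤ 1 - (1 - c) * s := by nlinarith
    refine Real.sqrt_le_iff.2 ⟨hpos, ?_⟩
    rw [div_le_iff₀ (by positivity)]
    have hc7 : 7 / 10 ≤ c := by nlinarith
    have hc8 : c ≤ 3 / 4 := by nlinarith
    have key : (1 - (1 - c) * s) ^ 2 * (1 + s) - 1 =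
        s * (1 - s) * ((2 * c - 1) - (3 / 2 - 2 * c) * s) := by
      linear_combination (s ^ 2 + s ^ 3) * hc2
    have h2 : 0 ≤ (2 * c - 1) - (3 / 2 - 2 * c) * s := by nlinarith
    have h3 : 0 ≤ s * (1 - s) * ((2 * c - 1) - (3 / 2 - 2 * c) * s) :=
      mul_nonneg (mul_nonneg hs0 (by linarith)) h2
    linarith
  have h2 : 1 - (1 - c) * s ≤ 1 - (1 - c) * √(1 - σ) := by nlinarith
  have h3 := Real.add_one_le_exp (-((1 - c) * √(1 - σ)))
  linarith

/-- With `σ² = 1 - s²` this reduces to `(2 + s)² (1 - s) = 4 - 3 s² - s³ ≤ 4`. It says that the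
characteristic polynomial `x² - (1 + κ) λ x + κ` has no two distinct real roots when `|λ| ≤ σ`, so
its roots have modulus `√κ`. -/
theorem mixing_cond {σ : ℝ} (hσ0 : 0 ≤ σ) (hσ1 : σ ≤ 1) :
    ((1 + 1 / (1 + √(1 - σ ^ 2))) / 2) ^ 2 * σ ^ 2 ≤ 1 / (1 + √(1 - σ ^ 2)) := by
  set s := √(1 - σ ^ 2) with hs
  have hs0 : 0 ≤ s := Real.sqrt_nonneg _
  have hs2 : s ^ 2 = 1 - σ ^ 2 := Real.sq_sqrt (by nlinarith)
  have hσ2 : σ ^ 2 = 1 - s ^ 2 := by linarith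
  rw [hσ2]
  have h1 : 0 < 1 + s := by linarith
  rw [show (1 + 1 / (1 + s)) / 2 = (2 + s) / (2 * (1 + s)) by field_simp; ring, div_pow,
    div_mul_eq_mul_div, div_le_div_iff₀ (by positivity) h1]
  nlinarith [mul_nonneg hs0 hs0, mul_nonneg (mul_nonneg hs0 hs0) hs0,
    mul_nonneg (mul_nonneg hs0 hs0) (mul_nonneg hs0 hs0),
    mul_nonneg (mul_nonneg (mul_nonneg hs0 hs0) (mul_nonneg hs0 hs0)) hs0]

/-- Subtracting the conserved mean preserves the recurrence because rows sum to one, and the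
deviations are orthogonal to the constants, where `W` contracts by `σ₂`. -/
theorem norm_gossipDev_le (hN : 0 < N) (hW : IsGossipMatrix G W) (hσ : sigma2 W < 1)
    (x : Fin N → Fin K → ℝ) (k : Fin K) (b : ℕ) :
    ‖gossipDev G W (mixing W) x k (b + 1)‖ ≤
      √(mixing W) ^ b * ((1 + 2 * b) * ‖gossipDev G W (mixing W) x k 0‖) := by
  have hσ0 := sigma2_nonneg W
  have hA : (Matrix.toEuclideanLin W).IsSymmetric := by
    rw [Matrix.isSymmetric_toEuclideanLin_iff]
    ext i j
    simpa using hW.isSymm.apply i j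
  have hN' : (N : ℝ) ≠ 0 := by positivity
  have hκ0 : 0 ≤ mixing W := by unfold mixing; positivity
  have hκ1 : mixing W ≤ 1 := by
    unfold mixing
    rw [div_le_one (by positivity)]
    linarith [Real.sqrt_nonneg (1 - sigma2 W ^ 2)]
  refine norm_le_of_momentum_recurrence (A := Matrix.toEuclideanLin W) hA hκ0 hκ1 hσ.le
    (mixing_cond hσ0 hσ.le) ?_ rfl ?_ b
  · intro b
    ext i
    simp only [gossipDev, PiLp.sub_apply, PiLp.smul_apply, smul_eq_mul,
      Matrix.toLpLin_apply, gossipPair_succ_fst, gossip_succ hW, Matrix.mulVec, dotProduct,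
      mul_sub, Finset.sum_sub_distrib, ← Finset.sum_mul, sum_row_of_mem_doublyStochastic hW.2]
    ring
  · intro b
    set e : EuclideanSpace ℝ (Fin N) := WithLp.toLp 2 fun _ => 1 with he
    refine norm_apply_le_singularValues_one hA (e := e) ?_ ?_ hσ ?_
    · intro h
      have := congrArg (fun v : EuclideanSpace ℝ (Fin N) => v ⟨0, hN⟩) h
      simp [he] at this
    · ext i
      simp [he, Matrix.mulVec, dotProduct,
        sum_row_of_mem_doublyStochastic hW.2]
    · simp only [he, gossipDev, PiLp.inner_apply, RCLike.inner_apply, conj_trivial, mul_one,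
        Finset.sum_sub_distrib, (sum_gossipPair hW _ x b k).1, Finset.sum_const, Finset.card_univ,
        Fintype.card_fin, nsmul_eq_mul]
      field_simp
      ring

/-- After `b` rounds of accelerated gossip every agent knows the mean approximately. -/
theorem abs_gossip_sub_mean_le (hN : 0 < N) (hW : IsGossipMatrix G W) (hσ : sigma2 W < 1)
    {x : Fin N → Fin K → ℝ} {X : ℝ} (hx : ∀ i k, |x i k| ≤ X) (b : ℕ) (i : Fin N) (k : Fin K) :
    |gossip G W (mixing W) x b i k - (∑ j, x j k) / N| ≤
      √(mixing W) ^ b * ((1 + 2 * b) * (√N * X)) := by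
  have h1 := norm_gossipDev_le hN hW hσ x k b
  have hX : 0 ≤ X := (abs_nonneg _).trans (hx i k)
  have h2 : |gossip G W (mixing W) x b i k - (∑ j, x j k) / N| ≤
      ‖gossipDev G W (mixing W) x k (b + 1)‖ := by
    have := PiLp.norm_apply_le (gossipDev G W (mixing W) x k (b + 1)) i
    simpa [gossipDev, gossipPair_succ_fst] using this
  have h3 : ‖gossipDev G W (mixing W) x k 0‖ ≤ √N * X := by
    refine le_of_sq_le_sq ?_ (by positivity)
    rw [EuclideanSpace.norm_sq_eq, mul_pow, Real.sq_sqrt (by positivity)]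
    simp only [gossipDev, gossipPair_zero_fst, Real.norm_eq_abs, sq_abs]
    set m := (∑ j, x j k) / (N : ℝ) with hm
    have hN' : (N : ℝ) ≠ 0 := by positivity
    have hsum : ∑ j, x j k = N * m := by rw [hm]; field_simp
    have h4 : ∑ j, (x j k - m) ^ 2 = ∑ j, x j k ^ 2 - N * m ^ 2 := by
      simp only [sub_sq, Finset.sum_add_distrib, Finset.sum_sub_distrib]
      rw [← Finset.sum_mul, ← Finset.mul_sum, hsum]
      simp
      ring
    have h5 : ∑ j, x j k ^ 2 ≤ ∑ _j : Fin N, X ^ 2 :=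
      Finset.sum_le_sum fun j _ => sq_le_sq' (abs_le.1 (hx j k)).1 (abs_le.1 (hx j k)).2
    simp at h5
    rw [h4]
    nlinarith [mul_nonneg (Nat.cast_nonneg (α := ℝ) N) (sq_nonneg m)]
  refine h2.trans (h1.trans ?_)
  gcongr

theorem blockLength_mul_ge (K T : ℕ) (hσ : sigma2 W < 1) :
    Real.log (((K : ℝ) * T) ^ 6 * √(14 * N)) ≤
      blockLength K T W * ((1 - 1 / √2) * √(1 - sigma2 W)) := by
  have h1 : 0 < 1 - 1 / √2 := by
    rw [sub_pos, div_lt_one (by positivity)]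
    exact Real.lt_sqrt_of_sq_lt (by norm_num)
  have h2 : 0 < √(1 - sigma2 W) := Real.sqrt_pos.2 (by linarith)
  have := Nat.le_ceil (Real.log (((K : ℝ) * T) ^ 6 * √(14 * N)) /
    ((1 - 1 / √2) * √(1 - sigma2 W)))
  rwa [div_le_iff₀ (by positivity)] at this

theorem sqrt_mixing_pow_blockLength_le (hN : 0 < N) {K T : ℕ} (hK : 0 < K) (hT : 0 < T)
    (hσ : sigma2 W < 1) :
    √(mixing W) ^ blockLength K T W ≤ (((K : ℝ) * T) ^ 6 * √(14 * N))⁻¹ := by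
  have hpos : 0 < ((K : ℝ) * T) ^ 6 * √(14 * N) := by positivity
  calc √(mixing W) ^ blockLength K T W
      ≤ Real.exp (-((1 - 1 / √2) * √(1 - sigma2 W))) ^ blockLength K T W :=
        pow_le_pow_left₀ (Real.sqrt_nonneg _) (sqrt_mixing_le (sigma2_nonneg W) hσ) _
    _ = Real.exp (-(blockLength K T W * ((1 - 1 / √2) * √(1 - sigma2 W)))) := by
        rw [← Real.exp_nat_mul]; congr 1; ring
    _ ≤ Real.exp (-Real.log (((K : ℝ) * T) ^ 6 * √(14 * N))) :=
        Real.exp_le_exp.2 (neg_le_neg (blockLength_mul_ge K T hσ))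
    _ = _ := by rw [Real.exp_neg, Real.exp_log hpos]

/-- The accuracy of the gossip over one block, if there are at least two blocks. -/
theorem abs_gossip_blockLength_sub_mean_le (hN : 0 < N) (hW : IsGossipMatrix G W)
    (hσ : sigma2 W < 1) {T : ℕ} (hK : 0 < K) (hT : 0 < T) (hB : blockLength K T W ≤ T)
    {x : Fin N → Fin K → ℝ} (hx : ∀ i k, |x i k| ≤ (T : ℝ) ^ 2 * K) (i : Fin N) (k : Fin K) :
    |gossip G W (mixing W) x (blockLength K T W) i k - (∑ j, x j k) / N| ≤
      1 / ((K : ℝ) ^ 5 * T ^ 3) := by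
  refine (abs_gossip_sub_mean_le hN hW hσ hx _ i k).trans ?_
  have h1 := sqrt_mixing_pow_blockLength_le (W := W) hN hK hT hσ
  have hT1 : (1 : ℝ) ≤ T := by exact_mod_cast hT
  have hB' : (blockLength K T W : ℝ) ≤ T := by exact_mod_cast hB
  -- The factor `√(14 N)` in the block length cancels both the `3` from `1 + 2 B ≤ 3 T` and the `√N`
  -- from the Euclidean norm.
  have h14 : 3 * √N ≤ √(14 * N) := by
    rw [Real.sqrt_mul (by norm_num)]
    gcongr
    exact Real.le_sqrt_of_sq_le (by norm_num)
  have hsN : 0 < √(N : ℝ) := by positivity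
  have hK' : (0 : ℝ) < K := by positivity
  calc _ ≤ (((K : ℝ) * T) ^ 6 * √(14 * N))⁻¹ * ((T + 2 * T) * (√N * (T ^ 2 * K))) := by gcongr
    _ ≤ (((K : ℝ) * T) ^ 6 * (3 * √N))⁻¹ * ((T + 2 * T) * (√N * (T ^ 2 * K))) := by
      gcongr
    _ = 1 / ((K : ℝ) ^ 5 * T ^ 3) := by field_simp; ring

end Gossip

/-! ### Follow the regularized leader with the hybrid regularizer -/

section Ftrl

variable {K : ℕ}

/-- The hybrid regularizer on positive vectors. -/
def hybridVal (η γ : ℝ) (q : Fin K → ℝ) : ℝ :=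
  1 / η * ∑ k, q k * Real.log (q k) - 1 / γ * ∑ k, Real.log (q k)

/-- The gradient of the hybrid regularizer, up to a multiple of `𝟏`. -/
def hybridGrad (η γ : ℝ) (q : Fin K → ℝ) (k : Fin K) : ℝ :=
  1 / η * Real.log (q k) - 1 / (γ * q k)

/-- The Bregman divergence of the hybrid regularizer. -/
def hybridBreg (η γ : ℝ) (x q : Fin K → ℝ) : ℝ :=
  ∑ k, (1 / η * (x k * Real.log (x k / q k) - x k + q k) +
    1 / γ * (x k / q k - 1 - Real.log (x k / q k)))

/-- The first-order optimality condition for `argmin_{q ∈ Δ(K)} {⟨S, q⟩ + ψ(q)}`. -/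
structure IsFtrlOpt (η γ : ℝ) (S q : Fin K → ℝ) : Prop where
  mem : q ∈ stdSimplex ℝ (Fin K)
  pos : ∀ k, 0 < q k
  opt : ∀ x ∈ stdSimplex ℝ (Fin K), 0 ≤ ∑ k, (S k + hybridGrad η γ q k) * (x k - q k)

/-- Multiply `x ≤ sinh x` at `x = -log r` by `r`. Quadratic lower bounds are needed only for `r ≤
1`, since with nonnegative losses only decreasing coordinates cost stability. -/
theorem entropy_div_ge {r : ℝ} (hr : 0 < r) (hr1 : r ≤ 1) :
    (1 - r) ^ 2 / 2 ≤ r * Real.log r - r + 1 := by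
  have h : -Real.log r ≤ Real.sinh (-Real.log r) :=
    Real.self_le_sinh_iff.2 (neg_nonneg.2 (Real.log_nonpos hr.le hr1))
  rw [Real.sinh_eq, neg_neg, Real.exp_log hr, Real.exp_neg, Real.exp_log hr] at h
  have h2 := mul_le_mul_of_nonneg_left h hr.le
  have h3 : r * ((r⁻¹ - r) / 2) = (1 - r ^ 2) / 2 := by field_simp
  rw [h3] at h2
  nlinarith

/-- The first two terms of the series of `-log (1 - (1 - r))`, all of whose terms are nonnegative.
-/
theorem logBarrier_div_ge {r : ℝ} (hr : 0 < r) (hr1 : r ≤ 1) :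
    (1 - r) ^ 2 / 2 ≤ r - 1 - Real.log r := by
  have h := Real.hasSum_pow_div_log_of_abs_lt_one (x := 1 - r)
    (by rw [abs_lt]; constructor <;> linarith)
  have h2 := sum_le_hasSum (Finset.range 2) (fun i _ => by
    have : 0 ≤ 1 - r := by linarith
    positivity) h
  simp [Finset.sum_range_succ] at h2
  norm_num at h2
  linarith

theorem entropy_div_nonneg {r : ℝ} (hr : 0 < r) : 0 ≤ r * Real.log r - r + 1 := by
  have h := Real.one_sub_inv_le_log_of_pos hr
  have h2 := mul_le_mul_of_nonneg_left h hr.le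
  rw [mul_sub, mul_inv_cancel₀ hr.ne'] at h2
  linarith

theorem logBarrier_div_nonneg {r : ℝ} (hr : 0 < r) : 0 ≤ r - 1 - Real.log r := by
  linarith [Real.log_le_sub_one_of_pos hr]

theorem hybridBreg_nonneg {η γ : ℝ} (hη : 0 < η) (hγ : 0 < γ) {x q : Fin K → ℝ}
    (hx : ∀ k, 0 < x k) (hq : ∀ k, 0 < q k) : 0 ≤ hybridBreg η γ x q := by
  refine Finset.sum_nonneg fun k _ => ?_
  have hr : 0 < x k / q k := div_pos (hx k) (hq k)
  have h1 : x k * Real.log (x k / q k) - x k + q k =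
      q k * (x k / q k * Real.log (x k / q k) - x k / q k + 1) := by
    have := (hq k).ne'
    field_simp
  rw [h1]
  have h2 := entropy_div_nonneg hr
  have h3 := logBarrier_div_nonneg hr
  have := (hq k).le
  positivity

/-- The defining identity of the Bregman divergence. The constant `1/η` dropped from the gradient is
harmless because the two vectors have equal sums. -/
theorem hybridVal_eq {η γ : ℝ} {x q : Fin K → ℝ}
    (hx : ∀ k, 0 < x k) (hq : ∀ k, 0 < q k) (hxq : ∑ k, x k = ∑ k, q k) :
    hybridVal η γ x = hybridVal η γ q + ∑ k, hybridGrad η γ q k * (x k - q k)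
      + hybridBreg η γ x q := by
  have h1 : ∑ k, 1 / η * (x k - q k) = 0 := by
    rw [← Finset.mul_sum, Finset.sum_sub_distrib, hxq]; ring
  rw [← sub_eq_zero]
  simp only [hybridVal, hybridBreg, Finset.mul_sum, ← Finset.sum_sub_distrib,
    ← Finset.sum_add_distrib]
  rw [← h1]
  refine Finset.sum_congr rfl fun k _ => ?_
  rw [Real.log_div (hx k).ne' (hq k).ne', hybridGrad]
  have := (hq k).ne'
  have e : 1 / (γ * q k) * (x k - q k) = 1 / γ * (x k / q k - 1) := by
    rw [one_div_mul_eq_div, one_div_mul_eq_div, div_sub_one this, div_div, mul_comm]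
  rw [sub_mul, e]
  ring

theorem IsFtrlOpt.le {η γ : ℝ} {S q x : Fin K → ℝ} (h : IsFtrlOpt η γ S q)
    (hx : x ∈ stdSimplex ℝ (Fin K)) (hx0 : ∀ k, 0 < x k) :
    ∑ k, S k * q k + hybridVal η γ q + hybridBreg η γ x q ≤
      ∑ k, S k * x k + hybridVal η γ x := by
  rw [hybridVal_eq hx0 h.pos (hx.2.trans h.mem.2.symm)]
  have h1 := h.opt x hx
  simp only [add_mul, Finset.sum_add_distrib, mul_sub, Finset.sum_sub_distrib] at h1 ⊢
  linarith

/-- The gradient at the uniform vector is constant, hence orthogonal to differences of points of the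
simplex. So the prescribed first output is itself the FTRL point for zero cumulative loss. -/
theorem isFtrlOpt_uniform (hK : 0 < K) (η γ : ℝ) :
    IsFtrlOpt η γ 0 (fun _ : Fin K => 1 / (K : ℝ)) := by
  have hK' : (0 : ℝ) < K := by positivity
  have hmem : (fun _ : Fin K => 1 / (K : ℝ)) ∈ stdSimplex ℝ (Fin K) :=
    ⟨fun _ => by positivity, by simp [hK'.ne']⟩
  refine ⟨hmem, fun _ => by positivity, fun x hx => ?_⟩
  simp only [hybridGrad, Pi.zero_apply, zero_add, ← Finset.mul_sum, Finset.sum_sub_distrib]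
  rw [hx.2, hmem.2]
  simp

theorem hybridReg_of_pos {η γ : ℝ} {q : Fin K → ℝ} (hq : ∀ k, 0 < q k) :
    hybridReg η γ q = (hybridVal η γ q : EReal) := by
  simp [hybridReg, hq, hybridVal]

/-- The log-barrier forces every positive point doing at least as well as the uniform one to have
coordinates at least `exp (-R)`. On this compact part of the simplex the objective is continuous. -/
theorem exists_isMinOn_hybridReg (hK : 0 < K) {η γ : ℝ} (hη : 0 < η) (hγ : 0 < γ)
    (S : Fin K → ℝ) : ∃ q ∈ stdSimplex ℝ (Fin K),
      IsMinOn (fun q' => ((∑ k, S k * q' k : ℝ) : EReal) + hybridReg η γ q')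
        (stdSimplex ℝ (Fin K)) q := by
  set Φ : (Fin K → ℝ) → ℝ := fun q => ∑ k, S k * q k + hybridVal η γ q with hΦ
  set un : Fin K → ℝ := fun _ => 1 / (K : ℝ) with hun
  have hunΔ := (isFtrlOpt_uniform hK η γ).mem
  have hun0 := (isFtrlOpt_uniform hK η γ).pos
  set R := γ * (Φ un + ∑ k, |S k| + 1 / η * K) with hR
  have hlow : ∀ q ∈ stdSimplex ℝ (Fin K), (∀ k, 0 < q k) → Φ q ≤ Φ un →
      ∀ k, Real.exp (-R) ≤ q k := by
    intro q hq hq0 hle k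
    have hq1 : ∀ k, q k ≤ 1 := fun k => by
      rw [← hq.2]; exact Finset.single_le_sum (fun i _ => hq.1 i) (Finset.mem_univ k)
    have h1 : -∑ k, |S k| ≤ ∑ k, S k * q k := by
      rw [← Finset.sum_neg_distrib]
      refine Finset.sum_le_sum fun k _ => ?_
      have : |S k * q k| ≤ |S k| := by
        rw [abs_mul, abs_of_pos (hq0 k)]
        exact mul_le_of_le_one_right (abs_nonneg _) (hq1 k)
      exact (abs_le.1 this).1.trans' (by simp)
    have h2 : -(1 / η * K) ≤ 1 / η * ∑ k, q k * Real.log (q k) := by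
      rw [← mul_neg]
      refine mul_le_mul_of_nonneg_left ?_ (by positivity)
      calc -(K : ℝ) = ∑ _k : Fin K, (-1 : ℝ) := by simp
        _ ≤ _ := Finset.sum_le_sum fun k _ => by linarith [entropy_div_nonneg (hq0 k), hq0 k]
    have h3 : 1 / γ * ∑ k, Real.log (q k) ≤ 1 / γ * Real.log (q k) := by
      refine mul_le_mul_of_nonneg_left ?_ (by positivity)
      rw [← Finset.add_sum_erase _ _ (Finset.mem_univ k)]
      have : ∑ j ∈ Finset.univ.erase k, Real.log (q j) ≤ 0 :=
        Finset.sum_nonpos fun j _ => Real.log_nonpos (hq.1 j) (hq1 j)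
      linarith
    have h4 : -(1 / γ * Real.log (q k)) ≤ Φ un + ∑ k, |S k| + 1 / η * K := by
      simp only [hΦ, hybridVal] at hle ⊢
      linarith
    have h5 : -Real.log (q k) ≤ R := by
      have := mul_le_mul_of_nonneg_left h4 hγ.le
      rw [← hR] at this
      have e : γ * -(1 / γ * Real.log (q k)) = -Real.log (q k) := by field_simp
      linarith
    rw [← Real.exp_log (hq0 k)]
    exact Real.exp_le_exp.2 (by linarith)
  set Cs : Set (Fin K → ℝ) := stdSimplex ℝ (Fin K) ∩ {q | ∀ k, Real.exp (-R) ≤ q k} with hCs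
  have hcomp : IsCompact Cs := by
    refine (isCompact_stdSimplex ℝ (Fin K)).inter_right ?_
    simp only [Set.ofPred_forall]
    exact isClosed_iInter fun k => isClosed_le continuous_const (continuous_apply k)
  have hunC : un ∈ Cs := ⟨hunΔ, hlow un hunΔ hun0 le_rfl⟩
  have hCpos : ∀ q ∈ Cs, ∀ k, 0 < q k := fun q hq k => (Real.exp_pos _).trans_le (hq.2 k)
  have hcont : ContinuousOn Φ Cs := by
    simp only [hΦ, hybridVal]
    have hl : ∀ k, ContinuousOn (fun q : Fin K → ℝ => Real.log (q k)) Cs := fun k =>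
      ContinuousOn.log (continuous_apply k).continuousOn fun q hq => (hCpos q hq k).ne'
    fun_prop
  obtain ⟨q, hqC, hmin⟩ := hcomp.exists_isMinOn ⟨un, hunC⟩ hcont
  refine ⟨q, hqC.1, fun x hx => ?_⟩
  simp only [Set.mem_ofPred_eq]
  by_cases hx0 : ∀ k, 0 < x k
  · rw [hybridReg_of_pos hx0, hybridReg_of_pos (hCpos q hqC), ← EReal.coe_add, ← EReal.coe_add,
      EReal.coe_le_coe_iff]
    by_cases hle : Φ x ≤ Φ un
    · exact hmin ⟨hx, hlow x hx hx0 hle⟩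
    · exact (hmin hunC).trans (not_le.1 hle).le
  · have : hybridReg η γ x = ⊤ := by simp only [hybridReg, if_neg hx0]
    rw [this, EReal.coe_add_top]
    exact le_top

theorem nonneg_deriv_of_min_right {f : ℝ → ℝ} {f' : ℝ} (hf : HasDerivAt f f' 0)
    (hmin : ∀ t, 0 < t → t < 1 → f 0 ≤ f t) : 0 ≤ f' := by
  refine ge_of_tendsto hf.tendsto_slope_zero_right ?_
  have : Set.Ioo (0 : ℝ) 1 ∈ nhdsWithin (0 : ℝ) (Set.Ioi 0) := Ioo_mem_nhdsGT one_pos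
  filter_upwards [this] with t ht
  have := hmin t ht.1 ht.2
  simp only [zero_add, smul_eq_mul]
  exact mul_nonneg (inv_nonneg.2 ht.1.le) (by linarith)

/-- The minimizer is positive because the uniform vector has finite value. The objective along the
segment from it towards `x` stays finite before the endpoint, so its right derivative at zero is
nonnegative even if `x` lies on the boundary. -/
theorem isFtrlOpt_regArgmin (hK : 0 < K) {η γ : ℝ} (hη : 0 < η) (hγ : 0 < γ) (S : Fin K → ℝ) :
    IsFtrlOpt η γ S (regArgmin (hybridReg η γ) S) := by
  obtain ⟨hmem, hmin⟩ := Classical.epsilon_spec (exists_isMinOn_hybridReg hK hη hγ S)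
  change regArgmin (hybridReg η γ) S ∈ _ at hmem
  change IsMinOn _ _ (regArgmin (hybridReg η γ) S) at hmin
  set q := regArgmin (hybridReg η γ) S with hq
  have hunΔ := (isFtrlOpt_uniform hK η γ).mem
  have hun0 := (isFtrlOpt_uniform hK η γ).pos
  have hpos : ∀ k, 0 < q k := by
    by_contra h0
    have h1 := hmin hunΔ
    simp only [Set.mem_ofPred_eq] at h1
    have : hybridReg η γ q = ⊤ := by simp only [hybridReg, if_neg h0]
    rw [this, EReal.coe_add_top, hybridReg_of_pos hun0, ← EReal.coe_add, top_le_iff] at h1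
    exact EReal.coe_ne_top _ h1
  refine ⟨hmem, hpos, fun x hx => ?_⟩
  set l : ℝ → Fin K → ℝ := fun t k => q k + t * (x k - q k) with hl
  have hlk : ∀ k, HasDerivAt (fun t => l t k) (x k - q k) 0 := fun k => by
    simpa [hl] using ((hasDerivAt_id (0 : ℝ)).mul_const (x k - q k)).const_add (q k)
  have hl0 : ∀ k, l 0 k = q k := fun k => by simp [hl]
  have hlog : ∀ k, HasDerivAt (fun t => Real.log (l t k)) ((x k - q k) / q k) 0 := fun k => by
    have := (hlk k).log (by rw [hl0]; exact (hpos k).ne')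
    rwa [hl0] at this
  have hd : HasDerivAt (fun t => ∑ k, S k * l t k + hybridVal η γ (l t))
      (∑ k, S k * (x k - q k) + (1 / η * ∑ k, ((x k - q k) * Real.log (q k) +
        q k * ((x k - q k) / q k)) - 1 / γ * ∑ k, (x k - q k) / q k)) 0 := by
    unfold hybridVal
    refine HasDerivAt.add (HasDerivAt.fun_sum fun k _ => (hlk k).const_mul _)
      (HasDerivAt.sub (HasDerivAt.const_mul _ (HasDerivAt.fun_sum fun k _ => ?_))
        (HasDerivAt.const_mul _ (HasDerivAt.fun_sum fun k _ => hlog k)))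
    have := (hlk k).mul (hlog k)
    rwa [hl0] at this
  have h1 := nonneg_deriv_of_min_right hd fun t ht0 ht1 => by
    have hlpos : ∀ k, 0 < l t k := fun k => by
      have e : l t k = (1 - t) * q k + t * x k := by simp only [hl]; ring
      have := mul_pos (sub_pos.2 ht1) (hpos k)
      have := mul_nonneg ht0.le (hx.1 k)
      linarith
    have hlΔ : l t ∈ stdSimplex ℝ (Fin K) := by
      refine ⟨fun k => (hlpos k).le, ?_⟩
      simp only [hl, Finset.sum_add_distrib, ← Finset.mul_sum, Finset.sum_sub_distrib, hmem.2, hx.2]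
      ring
    have h2 := hmin hlΔ
    simp only [Set.mem_ofPred_eq] at h2
    rw [hybridReg_of_pos hpos, hybridReg_of_pos hlpos, ← EReal.coe_add, ← EReal.coe_add,
      EReal.coe_le_coe_iff] at h2
    have e0 : l 0 = q := funext hl0
    rw [e0]
    exact h2
  have e : ∑ k, (S k + hybridGrad η γ q k) * (x k - q k) = ∑ k, S k * (x k - q k) +
      (1 / η * ∑ k, ((x k - q k) * Real.log (q k) +
        q k * ((x k - q k) / q k)) - 1 / γ * ∑ k, (x k - q k) / q k) := by
    have h3 : ∑ k, 1 / η * (x k - q k) = 0 := by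
      rw [← Finset.mul_sum, Finset.sum_sub_distrib, hx.2, hmem.2]; ring
    rw [← add_zero (∑ k, (S k + hybridGrad η γ q k) * (x k - q k)), ← h3]
    simp only [Finset.mul_sum, ← Finset.sum_sub_distrib, ← Finset.sum_add_distrib]
    refine Finset.sum_congr rfl fun k _ => ?_
    have := (hpos k).ne'
    rw [hybridGrad, mul_div_cancel₀ _ this, one_div_mul_eq_div γ, div_div, mul_comm (q k) γ]
    ring
  rw [e]
  exact h1

/-- The outputs of FTRL satisfy the first-order optimality condition. -/
theorem isFtrlOpt_ftrl (hK : 0 < K) {η γ : ℝ} (hη : 0 < η) (hγ : 0 < γ) (z : ℕ → Fin K → ℝ)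
    (s : ℕ) : IsFtrlOpt η γ (fun k => ∑ r ∈ Finset.range s, z (r + 1) k)
      (ftrl (fun _ => hybridReg η γ) z (s + 1)) := by
  rcases Nat.eq_zero_or_pos s with rfl | hs
  · simp only [ftrl, Finset.range_zero, Finset.sum_empty, zero_add, le_refl, if_true]
    exact isFtrlOpt_uniform hK η γ
  · have h1 : ¬ s + 1 ≤ 1 := by omega
    have h2 : ∀ k, ∑ r ∈ Finset.Icc 1 s, z r k = ∑ r ∈ Finset.range s, z (r + 1) k := fun k => by
      rw [Finset.range_eq_Ico, Finset.sum_Ico_add' (fun r => z r k)]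
      rfl
    simp only [ftrl, if_neg h1, Nat.add_sub_cancel, h2]
    exact isFtrlOpt_regArgmin hK hη hγ _

/-- The regret of FTRL is at most the penalty plus the stability terms. -/
theorem ftrl_regret_le {η γ : ℝ} (hη : 0 < η) (hγ : 0 < γ) {g q : ℕ → Fin K → ℝ}
    (h : ∀ s, IsFtrlOpt η γ (fun k => ∑ r ∈ Finset.range s, g r k) (q s))
    {u : Fin K → ℝ} (hu : u ∈ stdSimplex ℝ (Fin K)) (hu0 : ∀ k, 0 < u k) (n : ℕ) :
    ∑ s ∈ Finset.range n, ∑ k, (q s k - u k) * g s k ≤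
      hybridVal η γ u - hybridVal η γ (q 0) + ∑ s ∈ Finset.range n,
        (∑ k, (q s k - q (s + 1) k) * g s k - hybridBreg η γ (q (s + 1)) (q s)) := by
  -- Be-the-leader induction: optimality of `q n`, tested at `q (n + 1)`, yields the Bregman term
  -- that is kept to pay for stability.
  have key : ∀ n, ∑ s ∈ Finset.range n, ∑ k, q s k * g s k + hybridVal η γ (q 0) ≤
      ∑ k, (∑ r ∈ Finset.range n, g r k) * q n k + hybridVal η γ (q n) +
      ∑ s ∈ Finset.range n,
        (∑ k, (q s k - q (s + 1) k) * g s k - hybridBreg η γ (q (s + 1)) (q s)) := by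
    intro n
    induction n with
    | zero => simp
    | succ n ih =>
      have h1 := (h n).le (h (n + 1)).mem (h (n + 1)).pos
      have h2 : ∑ k, (∑ r ∈ Finset.range (n + 1), g r k) * q (n + 1) k =
          ∑ k, (∑ r ∈ Finset.range n, g r k) * q (n + 1) k + ∑ k, q (n + 1) k * g n k := by
        rw [← Finset.sum_add_distrib]
        refine Finset.sum_congr rfl fun k _ => ?_
        rw [Finset.sum_range_succ]; ring
      have h3 : ∑ k, (q n k - q (n + 1) k) * g n k =
          ∑ k, q n k * g n k - ∑ k, q (n + 1) k * g n k := by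
        rw [← Finset.sum_sub_distrib]
        exact Finset.sum_congr rfl fun k _ => by ring
      rw [Finset.sum_range_succ, Finset.sum_range_succ _ n, h2, h3]
      linarith
  have h1 := key n
  have h2 := (h n).le hu hu0
  have h3 := hybridBreg_nonneg hη hγ hu0 (h n).pos
  have h4 : ∑ s ∈ Finset.range n, ∑ k, (q s k - u k) * g s k =
      ∑ s ∈ Finset.range n, ∑ k, q s k * g s k - ∑ k, (∑ r ∈ Finset.range n, g r k) * u k := by
    simp only [Finset.sum_mul]
    rw [Finset.sum_comm (s := Finset.univ), ← Finset.sum_sub_distrib]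
    refine Finset.sum_congr rfl fun s _ => ?_
    rw [← Finset.sum_sub_distrib]
    exact Finset.sum_congr rfl fun k _ => by ring
  rw [h4]
  linarith

/-- If the coordinate grows, the left side is nonpositive since `y ≥ 0`. If it shrinks, split `y = c
+ (y - c)` with `c` arbitrary: the entropy divergence pays for `c`, the log-barrier divergence for
`y - c`, each by completing a square in `1 - x/q`. No upper bound on `η y` or `γ q y` is required.
-/
theorem stability_coord_le {η γ : ℝ} (hη : 0 < η) (hγ : 0 < γ) {x q y c : ℝ}
    (hx : 0 < x) (hq : 0 < q) (hy : 0 ≤ y) :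
    (q - x) * y - (1 / η * (x * Real.log (x / q) - x + q) +
      1 / γ * (x / q - 1 - Real.log (x / q))) ≤
      η / 2 * (q * c ^ 2) + γ / 2 * (q ^ 2 * (y - c) ^ 2) := by
  have hr : 0 < x / q := div_pos hx hq
  have h1 : x * Real.log (x / q) - x + q = q * (x / q * Real.log (x / q) - x / q + 1) := by
    field_simp
  rw [h1]
  have hrhs1 : 0 ≤ η / 2 * (q * c ^ 2) := by positivity
  have hrhs2 : 0 ≤ γ / 2 * (q ^ 2 * (y - c) ^ 2) := by positivity
  rcases le_total q x with h | h
  · have h2 := entropy_div_nonneg hr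
    have h3 := logBarrier_div_nonneg hr
    have h4 : 0 ≤ 1 / η * (q * (x / q * Real.log (x / q) - x / q + 1)) := by positivity
    have h5 : 0 ≤ 1 / γ * (x / q - 1 - Real.log (x / q)) := by positivity
    have h6 : (q - x) * y ≤ 0 := mul_nonpos_of_nonpos_of_nonneg (by linarith) hy
    linarith
  · set r := x / q with hrdef
    have hxr : x = r * q := by rw [hrdef]; field_simp
    have hr1 : r ≤ 1 := by rw [hrdef, div_le_one hq]; exact h
    have h2 := entropy_div_ge hr hr1
    have h3 := logBarrier_div_ge hr hr1
    have h4 : 1 / η * (q * ((1 - r) ^ 2 / 2)) ≤ 1 / η * (q * (r * Real.log r - r + 1)) := by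
      gcongr
    have h5 : 1 / γ * ((1 - r) ^ 2 / 2) ≤ 1 / γ * (r - 1 - Real.log r) := by gcongr
    have h6 : (q - x) * c - 1 / η * (q * ((1 - r) ^ 2 / 2)) ≤ η / 2 * (q * c ^ 2) := by
      have e : η / 2 * (q * c ^ 2) - ((q - x) * c - 1 / η * (q * ((1 - r) ^ 2 / 2))) =
          q / (2 * η) * ((1 - r) - η * c) ^ 2 := by
        rw [hxr]; field_simp; ring
      have : 0 ≤ q / (2 * η) * ((1 - r) - η * c) ^ 2 := by positivity
      linarith
    have h7 : (q - x) * (y - c) - 1 / γ * ((1 - r) ^ 2 / 2) ≤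
        γ / 2 * (q ^ 2 * (y - c) ^ 2) := by
      have e : γ / 2 * (q ^ 2 * (y - c) ^ 2) -
          ((q - x) * (y - c) - 1 / γ * ((1 - r) ^ 2 / 2)) =
          1 / (2 * γ) * ((1 - r) - γ * q * (y - c)) ^ 2 := by
        rw [hxr]; field_simp; ring
      have : 0 ≤ 1 / (2 * γ) * ((1 - r) - γ * q * (y - c)) ^ 2 := by positivity
      linarith
    have h8 : (q - x) * y = (q - x) * c + (q - x) * (y - c) := by ring
    linarith

theorem abs_sum_sub_mul_le {p q e : Fin K → ℝ} (hp : p ∈ stdSimplex ℝ (Fin K))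
    (hq : q ∈ stdSimplex ℝ (Fin K)) {ε : ℝ} (he : ∀ k, |e k| ≤ ε) :
    |∑ k, (p k - q k) * e k| ≤ 2 * ε := by
  calc |∑ k, (p k - q k) * e k| ≤ ∑ k, |(p k - q k) * e k| := Finset.abs_sum_le_sum_abs _ _
    _ ≤ ∑ k, (p k + q k) * ε := Finset.sum_le_sum fun k _ => by
        rw [abs_mul]
        have h1 : |p k - q k| ≤ p k + q k := by
          rw [abs_le]; constructor <;> linarith [hp.1 k, hq.1 k]
        exact mul_le_mul h1 (he k) (abs_nonneg _) (by linarith [hp.1 k, hq.1 k])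
    _ = 2 * ε := by
        rw [← Finset.sum_mul, Finset.sum_add_distrib, hp.2, hq.2]; ring

/-- The regret of FTRL on nonnegative losses `y` that are observed up to an error `ε`. -/
theorem ftrl_regret_le_of_approx {η γ : ℝ} (hη : 0 < η) (hγ : 0 < γ) {g q y c : ℕ → Fin K → ℝ}
    (h : ∀ s, IsFtrlOpt η γ (fun k => ∑ r ∈ Finset.range s, g r k) (q s))
    (hy : ∀ s k, 0 ≤ y s k) {ε : ℝ}
    (hgy : ∀ s k, |g s k - y s k| ≤ ε)
    {u : Fin K → ℝ} (hu : u ∈ stdSimplex ℝ (Fin K)) (hu0 : ∀ k, 0 < u k) (n : ℕ) :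
    ∑ s ∈ Finset.range n, ∑ k, (q s k - u k) * y s k ≤
      hybridVal η γ u - hybridVal η γ (q 0) + ∑ s ∈ Finset.range n,
        (∑ k, (η / 2 * (q s k * c s k ^ 2) + γ / 2 * (q s k ^ 2 * (y s k - c s k) ^ 2)) +
          4 * ε) := by
  have h1 := ftrl_regret_le hη hγ h hu hu0 n
  have h2 : ∑ s ∈ Finset.range n, ∑ k, (q s k - u k) * y s k ≤
      ∑ s ∈ Finset.range n, (∑ k, (q s k - u k) * g s k + 2 * ε) := by
    refine Finset.sum_le_sum fun s _ => ?_
    have h3 := (abs_le.1 (abs_sum_sub_mul_le (h s).mem hu (hgy s))).1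
    simp only [mul_sub, Finset.sum_sub_distrib] at h3
    linarith
  have h3 : ∑ s ∈ Finset.range n,
        (∑ k, (q s k - q (s + 1) k) * g s k - hybridBreg η γ (q (s + 1)) (q s)) ≤
      ∑ s ∈ Finset.range n,
        (∑ k, (η / 2 * (q s k * c s k ^ 2) + γ / 2 * (q s k ^ 2 * (y s k - c s k) ^ 2)) +
          2 * ε) := by
    refine Finset.sum_le_sum fun s _ => ?_
    have h4 := (abs_le.1 (abs_sum_sub_mul_le (h s).mem (h (s + 1)).mem (hgy s))).2
    simp only [mul_sub, Finset.sum_sub_distrib] at h4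
    -- Stability is applied to `y` rather than to the observed `g`, which need not be nonnegative;
    -- the exchange costs `2 ε` here, on top of the `2 ε` spent against the comparator.
    have h5 : ∑ k, (q s k - q (s + 1) k) * y s k - hybridBreg η γ (q (s + 1)) (q s) ≤
        ∑ k, (η / 2 * (q s k * c s k ^ 2) + γ / 2 * (q s k ^ 2 * (y s k - c s k) ^ 2)) := by
      rw [hybridBreg, ← Finset.sum_sub_distrib]
      exact Finset.sum_le_sum fun k _ =>
        stability_coord_le hη hγ ((h (s + 1)).pos k) ((h s).pos k) (hy s k)
    linarith
  simp only [Finset.sum_add_distrib, Finset.sum_const, Finset.card_range, nsmul_eq_mul]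
    at h2 h3 ⊢
  linarith

/-- Nearby cumulative losses lead to nearby outputs. -/
theorem IsFtrlOpt.sq_sub_le {η γ : ℝ} (hη : 0 < η) (hγ : 0 < γ) {S S' q q' : Fin K → ℝ}
    (h : IsFtrlOpt η γ S q) (h' : IsFtrlOpt η γ S' q') {δ : ℝ} (hδ : ∀ k, |S k - S' k| ≤ δ)
    {k : Fin K} (hk : q' k ≤ q k) : (q k - q' k) ^ 2 ≤ 2 * δ * η := by
  -- Adding the two variational inequalities bounds the monotonicity pairing of the gradients. All
  -- its coordinate terms are nonnegative, so a single one can be isolated, and its log-barrier part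
  -- may be discarded.
  have h1 := h.opt q' h'.mem
  have h2 := h'.opt q h.mem
  have h3 := (abs_le.1 (abs_sum_sub_mul_le h'.mem h.mem hδ)).2
  have h4 : ∑ k, (hybridGrad η γ q k - hybridGrad η γ q' k) * (q k - q' k) ≤ 2 * δ := by
    refine le_trans ?_ h3
    rw [← sub_nonneg, ← Finset.sum_sub_distrib]
    have := add_nonneg h1 h2
    rw [← Finset.sum_add_distrib] at this
    refine this.trans (le_of_eq (Finset.sum_congr rfl fun k _ => by ring))
  have hent : ∀ a b : ℝ, 0 < a → 0 < b → b ≤ a →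
      1 / η * ((1 - b / a) * (a - b)) ≤
        (1 / η * Real.log a - 1 / (γ * a) - (1 / η * Real.log b - 1 / (γ * b))) * (a - b) := by
    intro a b ha hb hab
    have e1 : 1 - b / a ≤ Real.log a - Real.log b := by
      have := Real.one_sub_inv_le_log_of_pos (div_pos ha hb)
      rwa [inv_div, Real.log_div ha.ne' hb.ne'] at this
    have e2 : 1 / (γ * a) ≤ 1 / (γ * b) := by gcongr
    have e3 : 0 ≤ a - b := by linarith
    rw [← mul_assoc]
    refine mul_le_mul_of_nonneg_right ?_ e3
    have := mul_le_mul_of_nonneg_left e1 (by positivity : 0 ≤ 1 / η)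
    linarith
  have hterm : ∀ a b : ℝ, 0 < a → 0 < b → b ≤ a → 0 ≤ 1 / η * ((1 - b / a) * (a - b)) := by
    intro a b ha hb hab
    have : 0 ≤ 1 - b / a := by rw [sub_nonneg, div_le_one ha]; exact hab
    have := sub_nonneg.2 hab
    positivity
  have h5 : (hybridGrad η γ q k - hybridGrad η γ q' k) * (q k - q' k) ≤ 2 * δ := by
    refine le_trans (Finset.single_le_sum (f := fun k =>
      (hybridGrad η γ q k - hybridGrad η γ q' k) * (q k - q' k)) (fun j _ => ?_)
      (Finset.mem_univ k)) h4
    rcases le_total (q' j) (q j) with hj | hj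
    · exact (hterm _ _ (h.pos j) (h'.pos j) hj).trans (hent _ _ (h.pos j) (h'.pos j) hj)
    · have := (hterm _ _ (h'.pos j) (h.pos j) hj).trans (hent _ _ (h'.pos j) (h.pos j) hj)
      simp only [hybridGrad]
      linarith
  have h6 := (hent _ _ (h.pos k) (h'.pos k) hk).trans h5
  have hq1 : q k ≤ 1 := by
    rw [← h.mem.2]; exact Finset.single_le_sum (fun i _ => h.mem.1 i) (Finset.mem_univ k)
  have h7 : q k - q' k ≤ 1 - q' k / q k := by
    rw [one_sub_div (h.pos k).ne']
    exact le_div_self (by linarith) (h.pos k) hq1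
  have h8 : (q k - q' k) ^ 2 ≤ (1 - q' k / q k) * (q k - q' k) := by
    rw [sq]; exact mul_le_mul_of_nonneg_right h7 (by linarith)
  rw [one_div_mul_eq_div, div_le_iff₀ hη] at h6
  linarith

/-- The entropy of `u` is nonpositive and that of the uniform vector is `-log K`. In the barrier,
`log (u k) ≥ -log T - log K`, and the `log K` cancels against the uniform vector; hence the
comparator is kept above `1/(TK)`. -/
theorem hybridVal_sub_uniform_le (hK : 0 < K) {η γ : ℝ} (hη : 0 < η) (hγ : 0 < γ) {T : ℝ}
    (hT : 0 < T) {u : Fin K → ℝ} (hu : u ∈ stdSimplex ℝ (Fin K))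
    (huT : ∀ k, 1 / (T * K) ≤ u k) :
    hybridVal η γ u - hybridVal η γ (fun _ : Fin K => 1 / (K : ℝ)) ≤
      Real.log K / η + K * Real.log T / γ := by
  have hK' : (0 : ℝ) < K := by positivity
  have hu0 : ∀ k, 0 < u k := fun k => lt_of_lt_of_le (by positivity) (huT k)
  have hu1 : ∀ k, u k ≤ 1 := fun k => by
    rw [← hu.2]; exact Finset.single_le_sum (fun i _ => hu.1 i) (Finset.mem_univ k)
  have h1 : ∑ k, u k * Real.log (u k) ≤ 0 := Finset.sum_nonpos fun k _ =>
    mul_nonpos_of_nonneg_of_nonpos (hu.1 k) (Real.log_nonpos (hu.1 k) (hu1 k))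
  have h2 : ∑ _k : Fin K, -Real.log (T * K) ≤ ∑ k, Real.log (u k) :=
    Finset.sum_le_sum fun k _ => by
      rw [← Real.log_inv, ← one_div]
      exact Real.log_le_log (by positivity) (huT k)
  rw [Real.log_mul hT.ne' hK'.ne'] at h2
  simp only [Finset.sum_const, Finset.card_univ, Fintype.card_fin, nsmul_eq_mul] at h2
  simp only [hybridVal, Finset.sum_const, Finset.card_univ, Fintype.card_fin, nsmul_eq_mul,
    one_div (K : ℝ), Real.log_inv]
  have h3 : 1 / η * ∑ k, u k * Real.log (u k) ≤ 0 :=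
    mul_nonpos_of_nonneg_of_nonpos (by positivity) h1
  have h4 := mul_le_mul_of_nonneg_left h2 (by positivity : 0 ≤ 1 / γ)
  have e1 : 1 / η * ((K : ℝ) * ((K : ℝ)⁻¹ * -Real.log K)) = -(Real.log K / η) := by
    field_simp
  have e2 : 1 / γ * ((K : ℝ) * -(Real.log T + Real.log K)) =
      1 / γ * ((K : ℝ) * -Real.log K) - K * Real.log T / γ := by ring
  rw [e1]
  linarith

end Ftrl

/-! ### Sequentially sampled coordinates -/

section Sampling

variable {I X : Type*} [Fintype I] [DecidableEq I] [Fintype X]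

/-- The map exchanging `x` with the coordinate `a u` is an involution on pairs. -/
theorem sum_sum_update (f : (I → X) → ℝ) (u : I) :
    ∑ a, ∑ x, f (Function.update a u x) = Fintype.card X * ∑ a, f a := by
  have hinv : Function.Involutive
      (fun p : (I → X) × X => (Function.update p.1 u p.2, p.1 u)) := by
    intro p; simp
  have h := Equiv.sum_comp (hinv.toPerm _) (fun p : (I → X) × X => f p.1)
  simp only [Function.Involutive.coe_toPerm, Fintype.sum_prod_type] at h
  rw [h]
  simp [Finset.mul_sum]

variable {rank : I → ℕ} {π : I → (I → X) → X → ℝ}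

/-- Integrates out a coordinate of maximal rank: no remaining conditional law in `D` depends on it.
The sum still runs over full configurations, with `u` now a dummy coordinate, hence the factor
`Fintype.card X`. -/
theorem sum_sum_prod_update (hπ : ∀ v a b, (∀ u, rank u < rank v → a u = b u) → π v a = π v b)
    {D : Finset I} {u : I} (hu : u ∈ D) (hmax : ∀ v ∈ D, rank v ≤ rank u) (f : (I → X) → ℝ) :
    Fintype.card X * ∑ a, (∏ v ∈ D, π v a (a v)) * f a =
      ∑ a, (∏ v ∈ D.erase u, π v a (a v)) *
        ∑ x, π u a x * f (Function.update a u x) := by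
  have hup : ∀ v ∈ D, ∀ a x, π v (Function.update a u x) = π v a := fun v hv a x =>
    hπ v _ _ fun w hw => Function.update_of_ne (fun h => by
      rw [h] at hw; exact absurd (hmax v hv) (not_le.2 hw)) _ _
  rw [← sum_sum_update _ u]
  refine Finset.sum_congr rfl fun a _ => ?_
  rw [Finset.mul_sum]
  refine Finset.sum_congr rfl fun x _ => ?_
  rw [← Finset.mul_prod_erase _ _ hu, hup u hu, Function.update_self]
  have : ∏ v ∈ D.erase u, π v (Function.update a u x) (Function.update a u x v) =
      ∏ v ∈ D.erase u, π v a (a v) := Finset.prod_congr rfl fun v hv => by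
    rw [hup v (Finset.mem_of_mem_erase hv), Function.update_of_ne (Finset.ne_of_mem_erase hv)]
  rw [this]; ring

/-- The total mass of a sequentially sampled law. -/
theorem sum_prod_eq_one [Nonempty X]
    (hπ : ∀ v a b, (∀ u, rank u < rank v → a u = b u) → π v a = π v b)
    (hsum : ∀ v a, ∑ x, π v a x = 1) : ∑ a : I → X, ∏ v, π v a (a v) = 1 := by
  have key : ∀ n, ∀ D : Finset I, D.card = n →
      (Fintype.card X : ℝ) ^ n * ∑ a : I → X, ∏ v ∈ D, π v a (a v) =
        (Fintype.card X : ℝ) ^ Fintype.card I := by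
    intro n
    induction n with
    | zero =>
      intro D hD
      rw [Finset.card_eq_zero] at hD
      simp [hD]
    | succ n ih =>
      intro D hD
      obtain ⟨u, hu, hmax⟩ := D.exists_max_image rank (Finset.card_pos.1 (by omega))
      have h1 := sum_sum_prod_update hπ hu hmax (fun _ => 1)
      simp only [mul_one, hsum] at h1
      rw [pow_succ, mul_assoc, h1]
      exact ih _ (by rw [Finset.card_erase_of_mem hu, hD]; rfl)
  have h1 := key _ Finset.univ rfl
  rw [Finset.card_univ] at h1
  exact mul_left_cancel₀ (by positivity) (h1.trans (mul_one _).symm)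

/-- A function that does not depend on the coordinates of rank above that of `v`, and whose
average over the coordinate `v` vanishes, has mean zero. -/
theorem sum_prod_mul_eq_zero [Nonempty X]
    (hπ : ∀ v a b, (∀ u, rank u < rank v → a u = b u) → π v a = π v b)
    (hsum : ∀ v a, ∑ x, π v a x = 1) (v : I) {Ψ : (I → X) → X → ℝ}
    (hΨ : ∀ a b x, (∀ u, u ≠ v → rank u ≤ rank v → a u = b u) → Ψ a x = Ψ b x)
    (h0 : ∀ a, ∑ x, π v a x * Ψ a x = 0) :
    ∑ a : I → X, (∏ u, π u a (a u)) * Ψ a (a v) = 0 := by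
  have hX : (Fintype.card X : ℝ) ≠ 0 := by positivity
  have key : ∀ n, ∀ D : Finset I, D.card = n → (∀ u, rank u ≤ rank v → u ∈ D) →
      ∑ a : I → X, (∏ u ∈ D, π u a (a u)) * Ψ a (a v) = 0 := by
    intro n
    induction n with
    | zero =>
      intro D hD hv
      rw [Finset.card_eq_zero] at hD
      simpa [hD] using hv v le_rfl
    | succ n ih =>
      intro D hD hv
      obtain ⟨u, hu, hmax⟩ := D.exists_max_image rank (Finset.card_pos.1 (by omega))
      refine (mul_eq_zero.1 ?_).resolve_left hX
      -- Coordinates of rank above that of `v` are removed one at a time. Once none is left, `v`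
      -- itself has maximal rank and is summed out first, so `Ψ` may depend on the other coordinates
      -- of the same rank.
      by_cases hr : rank u ≤ rank v
      · rw [sum_sum_prod_update hπ (hv v le_rfl) fun w hw => (hmax w hw).trans hr]
        refine Finset.sum_eq_zero fun a _ => ?_
        have : ∀ x, Ψ (Function.update a v x) (Function.update a v x v) = Ψ a x := fun x => by
          rw [Function.update_self]
          exact hΨ _ _ _ fun w hw _ => Function.update_of_ne hw _ _
        simp only [this, h0, mul_zero]
      · rw [sum_sum_prod_update hπ hu hmax]
        have hvu : v ≠ u := fun h => hr (h ▸ le_rfl)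
        have : ∀ a x, Ψ (Function.update a u x) (Function.update a u x v) = Ψ a (a v) :=
          fun a x => by
            rw [Function.update_of_ne hvu]
            exact hΨ _ _ _ fun w _ hw =>
              Function.update_of_ne (fun h => hr (by rw [← h]; exact hw)) _ _
        simp only [this, ← Finset.sum_mul, hsum, one_mul]
        exact ih _ (by rw [Finset.card_erase_of_mem hu, hD]; rfl) fun w hw =>
          Finset.mem_erase.2 ⟨fun h => hr (h ▸ hw), hv w hw⟩
  exact key _ Finset.univ rfl fun u _ => Finset.mem_univ u

end Sampling

/-! ### The law of the trajectory -/

section Trajectory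

variable {N K T : ℕ} (G : SimpleGraph (Fin N)) (W : Matrix (Fin N) (Fin N) ℝ) (κ : ℝ) (B : ℕ)
  (A : Learner K) (ℓ : Fin T → Fin N → Fin K → ℝ)

/-- The vectors `z_σ^B(i)` delivered at the end of block `σ`. -/
def deliver (a : Fin T → Fin N → Fin K) (σ : ℕ) : Fin N → Fin K → ℝ :=
  gossip G W κ (blockEstimate B ℓ a (σ - 1) (policy G W κ B A ℓ a (σ - 1))) B

/-- The outputs `p'_τ(i)` of the learners of the agents. -/
def learnerOut (a : Fin T → Fin N → Fin K) (τ : ℕ) (i : Fin N) : Fin K → ℝ :=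
  A (fun σ => deliver G W κ B A ℓ a σ i) τ

/-- The expectation with respect to the law of the trajectory. -/
def trajExp (f : (Fin T → Fin N → Fin K) → ℝ) : ℝ :=
  ∑ a, trajProb G W κ B A ℓ a * f a

/-- A learner whose output `τ` only depends on what is delivered in the blocks `2, …, τ - 1`. -/
def IsCausal (A : Learner K) : Prop :=
  ∀ Z Z' τ, (∀ σ, 2 ≤ σ → σ < τ → Z σ = Z' σ) → A Z τ = A Z' τ

variable {G W κ B A ℓ}

/-- By causality, replacing undelivered vectors by zero does not affect the output, so the
recursion's cut-off can be dropped. -/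
theorem policy_eq (hA : IsCausal A) (a : Fin T → Fin N → Fin K) (τ : ℕ) (i : Fin N) (k : Fin K) :
    policy G W κ B A ℓ a τ i k =
      (1 - 1 / (T : ℝ)) * learnerOut G W κ B A ℓ a τ i k + 1 / (T : ℝ) * (1 / (K : ℝ)) := by
  rw [policy, learnerOut]
  simp only
  refine congrArg (fun y : ℝ => (1 - 1 / (T : ℝ)) * y + 1 / (T : ℝ) * (1 / (K : ℝ)))
    (congrFun (hA _ _ _ fun σ h2 hσ => ?_) k)
  simp only [dif_pos (And.intro h2 hσ)]
  rfl

theorem blockEstimate_congr {a b : Fin T → Fin N → Fin K} {τ : ℕ}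
    (h : ∀ t : Fin T, blockOf B t = τ → a t = b t) (p : Fin N → Fin K → ℝ) :
    blockEstimate B ℓ a τ p = blockEstimate B ℓ b τ p := by
  funext i k
  refine Finset.sum_congr rfl fun t ht => ?_
  rw [h t (Finset.mem_filter.1 ht).2]

theorem policy_congr {a b : Fin T → Fin N → Fin K} (τ : ℕ)
    (h : ∀ t : Fin T, blockOf B t < τ → a t = b t) :
    policy G W κ B A ℓ a τ = policy G W κ B A ℓ b τ := by
  induction τ using Nat.strong_induction_on with
  | _ τ ih =>
    rw [policy, policy]
    have : ∀ σ, 2 ≤ σ ∧ σ < τ →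
        blockEstimate B ℓ a (σ - 1) (policy G W κ B A ℓ a (σ - 1)) =
        blockEstimate B ℓ b (σ - 1) (policy G W κ B A ℓ b (σ - 1)) := fun σ hσ => by
      rw [ih (σ - 1) (by omega) fun t ht => h t (by omega)]
      exact blockEstimate_congr (fun t ht => h t (by omega)) _
    funext i k
    have h2 : ∀ σ, (if _h : 2 ≤ σ ∧ σ < τ then
          gossip G W κ (blockEstimate B ℓ a (σ - 1) (policy G W κ B A ℓ a (σ - 1))) B else 0) =
        (if _h : 2 ≤ σ ∧ σ < τ then
          gossip G W κ (blockEstimate B ℓ b (σ - 1) (policy G W κ B A ℓ b (σ - 1))) B else 0) := by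
      intro σ
      split_ifs with hσ
      · rw [this σ hσ]
      · rfl
    simp only [h2]

theorem learnerOut_congr (hA : IsCausal A) {a b : Fin T → Fin N → Fin K} (τ : ℕ)
    (h : ∀ t : Fin T, blockOf B t < τ → a t = b t) :
    learnerOut G W κ B A ℓ a τ = learnerOut G W κ B A ℓ b τ := by
  funext i
  refine hA _ _ _ fun σ h2 hσ => ?_
  rw [deliver, deliver, policy_congr (σ - 1) fun t ht => h t (by omega),
    blockEstimate_congr fun t ht => h t (by omega)]

theorem policy_lower (hA : IsCausal A) (hΔ : ∀ Z τ, A Z τ ∈ stdSimplex ℝ (Fin K)) (hT : 0 < T)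
    (a : Fin T → Fin N → Fin K) (τ : ℕ) (i : Fin N) (k : Fin K) :
    1 / ((T : ℝ) * K) ≤ policy G W κ B A ℓ a τ i k := by
  rw [policy_eq hA]
  have h1 : 0 ≤ learnerOut G W κ B A ℓ a τ i k := (hΔ _ _).1 k
  have h2 : 1 / (T : ℝ) ≤ 1 := by
    rw [div_le_one (by positivity)]; exact_mod_cast hT
  have h3 : 0 ≤ (1 - 1 / (T : ℝ)) * learnerOut G W κ B A ℓ a τ i k :=
    mul_nonneg (by linarith) h1
  rw [div_mul_div_comm, one_mul]
  linarith

theorem policy_pos (hA : IsCausal A) (hΔ : ∀ Z τ, A Z τ ∈ stdSimplex ℝ (Fin K)) (hK : 0 < K)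
    (hT : 0 < T) (a : Fin T → Fin N → Fin K) (τ : ℕ) (i : Fin N) (k : Fin K) :
    0 < policy G W κ B A ℓ a τ i k :=
  lt_of_lt_of_le (by positivity) (policy_lower hA hΔ hT a τ i k)

theorem sum_policy (hA : IsCausal A) (hΔ : ∀ Z τ, A Z τ ∈ stdSimplex ℝ (Fin K)) (hK : 0 < K)
    (a : Fin T → Fin N → Fin K) (τ : ℕ) (i : Fin N) :
    ∑ k, policy G W κ B A ℓ a τ i k = 1 := by
  have h1 : ∑ k, learnerOut G W κ B A ℓ a τ i k = 1 := (hΔ _ _).2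
  have hK' : (K : ℝ) ≠ 0 := by positivity
  simp only [policy_eq hA, Finset.sum_add_distrib, ← Finset.mul_sum, h1, Finset.sum_const,
    Finset.card_univ, Fintype.card_fin, nsmul_eq_mul]
  field_simp
  ring

theorem trajProb_nonneg (hA : IsCausal A) (hΔ : ∀ Z τ, A Z τ ∈ stdSimplex ℝ (Fin K)) (hK : 0 < K)
    (hT : 0 < T) (a : Fin T → Fin N → Fin K) : 0 ≤ trajProb G W κ B A ℓ a :=
  Finset.prod_nonneg fun _ _ => Finset.prod_nonneg fun _ _ =>
    (policy_pos hA hΔ hK hT _ _ _ _).le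

theorem trajExp_mono (hA : IsCausal A) (hΔ : ∀ Z τ, A Z τ ∈ stdSimplex ℝ (Fin K)) (hK : 0 < K)
    (hT : 0 < T) {f g : (Fin T → Fin N → Fin K) → ℝ} (h : ∀ a, f a ≤ g a) :
    trajExp G W κ B A ℓ f ≤ trajExp G W κ B A ℓ g :=
  Finset.sum_le_sum fun a _ =>
    mul_le_mul_of_nonneg_left (h a) (trajProb_nonneg hA hΔ hK hT a)

theorem trajExp_add (f g : (Fin T → Fin N → Fin K) → ℝ) :
    trajExp G W κ B A ℓ (fun a => f a + g a) =
      trajExp G W κ B A ℓ f + trajExp G W κ B A ℓ g := by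
  simp only [trajExp, mul_add, Finset.sum_add_distrib]

theorem trajExp_sub (f g : (Fin T → Fin N → Fin K) → ℝ) :
    trajExp G W κ B A ℓ (fun a => f a - g a) =
      trajExp G W κ B A ℓ f - trajExp G W κ B A ℓ g := by
  simp only [trajExp, mul_sub, Finset.sum_sub_distrib]

theorem trajExp_const_mul (c : ℝ) (f : (Fin T → Fin N → Fin K) → ℝ) :
    trajExp G W κ B A ℓ (fun a => c * f a) = c * trajExp G W κ B A ℓ f := by
  simp only [trajExp, Finset.mul_sum]
  exact Finset.sum_congr rfl fun a _ => by ring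

theorem trajExp_sum {ι : Type*} (s : Finset ι) (f : ι → (Fin T → Fin N → Fin K) → ℝ) :
    trajExp G W κ B A ℓ (fun a => ∑ j ∈ s, f j a) = ∑ j ∈ s, trajExp G W κ B A ℓ (f j) := by
  simp only [trajExp, Finset.mul_sum]
  exact Finset.sum_comm

theorem uncurried_policy_congr (v : Fin T × Fin N) (a b : Fin T × Fin N → Fin K)
    (h : ∀ u : Fin T × Fin N, blockOf B u.1 < blockOf B v.1 → a u = b u) :
    policy G W κ B A ℓ (Function.curry a) (blockOf B v.1) v.2 =
      policy G W κ B A ℓ (Function.curry b) (blockOf B v.1) v.2 := by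
  rw [policy_congr (a := Function.curry a) (b := Function.curry b) (blockOf B v.1)
    fun t ht => funext fun i => h (t, i) ht]

/-- Flattens the index to pairs of a round and an agent, so that the sampling lemmas apply with the
block number as rank. -/
theorem trajExp_eq_uncurried (f : (Fin T → Fin N → Fin K) → ℝ) :
    trajExp G W κ B A ℓ f = ∑ a : Fin T × Fin N → Fin K,
      (∏ v : Fin T × Fin N,
        policy G W κ B A ℓ (Function.curry a) (blockOf B v.1) v.2 (a v)) *
        f (Function.curry a) := by
  rw [trajExp, ← Equiv.sum_comp (Equiv.curry (Fin T) (Fin N) (Fin K))]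
  refine Finset.sum_congr rfl fun a _ => ?_
  rw [Fintype.prod_prod_type]
  rfl

theorem trajExp_const (hA : IsCausal A) (hΔ : ∀ Z τ, A Z τ ∈ stdSimplex ℝ (Fin K)) (hK : 0 < K)
    (c : ℝ) : trajExp G W κ B A ℓ (fun _ => c) = c := by
  have : Nonempty (Fin K) := ⟨⟨0, hK⟩⟩
  rw [trajExp_eq_uncurried, ← Finset.sum_mul,
    sum_prod_eq_one (rank := fun v : Fin T × Fin N => blockOf B v.1)
      (π := fun v a => policy G W κ B A ℓ (Function.curry a) (blockOf B v.1) v.2)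
      uncurried_policy_congr (fun v a => sum_policy hA hΔ hK _ _ _), one_mul]

/-- The martingale-difference principle behind all moment computations. `Ψ` may use every other
action of the same block, since these are conditionally independent of the action at `(t, i)`. -/
theorem trajExp_eq_zero (hA : IsCausal A) (hΔ : ∀ Z τ, A Z τ ∈ stdSimplex ℝ (Fin K)) (hK : 0 < K)
    (t : Fin T) (i : Fin N) {Ψ : (Fin T → Fin N → Fin K) → Fin K → ℝ}
    (hΨ : ∀ a b x, (∀ s j, (s, j) ≠ (t, i) → blockOf B s ≤ blockOf B t → a s j = b s j) →
      Ψ a x = Ψ b x)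
    (h0 : ∀ a, ∑ x, policy G W κ B A ℓ a (blockOf B t) i x * Ψ a x = 0) :
    trajExp G W κ B A ℓ (fun a => Ψ a (a t i)) = 0 := by
  have : Nonempty (Fin K) := ⟨⟨0, hK⟩⟩
  rw [trajExp_eq_uncurried]
  exact sum_prod_mul_eq_zero (rank := fun v : Fin T × Fin N => blockOf B v.1)
      (π := fun v a => policy G W κ B A ℓ (Function.curry a) (blockOf B v.1) v.2)
      uncurried_policy_congr (fun v a => sum_policy hA hΔ hK _ _ _) (t, i)
      (Ψ := fun a x => Ψ (Function.curry a) x)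
      (fun a b x h => hΨ _ _ _ fun s j hne hle => h (s, j) hne hle) (fun a => h0 _)

end Trajectory

/-! ### First and second moments of the loss estimates -/

section Estimates

variable {N K T : ℕ} (G : SimpleGraph (Fin N)) (W : Matrix (Fin N) (Fin N) ℝ) (κ : ℝ) (B : ℕ)
  (A : Learner K) (ℓ : Fin T → Fin N → Fin K → ℝ)

/-- The rounds of block `τ`. -/
def blockRounds (T B τ : ℕ) : Finset (Fin T) :=
  Finset.univ.filter fun t => blockOf B t.val = τ

/-- The importance-weighted estimate of the loss of action `k` of agent `j` in round `t`. -/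
def roundEstimate (a : Fin T → Fin N → Fin K) (v : Fin T × Fin N) (k : Fin K) : ℝ :=
  if a v.1 v.2 = k then ℓ v.1 v.2 k / policy G W κ B A ℓ a (blockOf B v.1) v.2 k else 0

/-- The mean over the agents of the loss estimates of block `τ`. -/
def meanEstimate (a : Fin T → Fin N → Fin K) (τ : ℕ) (k : Fin K) : ℝ :=
  (∑ j, blockEstimate B ℓ a τ (policy G W κ B A ℓ a τ) j k) / N

/-- The global average loss of block `τ`. -/
def blockLoss (τ : ℕ) (k : Fin K) : ℝ := ∑ t ∈ blockRounds T B τ, avgLoss ℓ t k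

variable {G W κ B A ℓ}

theorem mem_blockRounds {τ : ℕ} {t : Fin T} : t ∈ blockRounds T B τ ↔ blockOf B t = τ := by
  simp [blockRounds]

theorem meanEstimate_eq (a : Fin T → Fin N → Fin K) (τ : ℕ) (k : Fin K) :
    meanEstimate G W κ B A ℓ a τ k =
      1 / (N : ℝ) * ∑ v ∈ blockRounds T B τ ×ˢ Finset.univ, roundEstimate G W κ B A ℓ a v k := by
  rw [meanEstimate, Finset.sum_product, Finset.sum_comm, one_div_mul_eq_div]
  congr 1
  refine Finset.sum_congr rfl fun j _ => Finset.sum_congr rfl fun t ht => ?_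
  rw [roundEstimate, mem_blockRounds.1 ht]

theorem blockLoss_eq (τ : ℕ) (k : Fin K) : blockLoss B ℓ τ k =
    1 / (N : ℝ) * ∑ v ∈ blockRounds T B τ ×ˢ (Finset.univ : Finset (Fin N)), ℓ v.1 v.2 k := by
  simp only [blockLoss, avgLoss, Finset.sum_product, Finset.mul_sum]

/-- A function of the trajectory that is determined before block `τ`. -/
def IsPredictable (B τ : ℕ) (H : (Fin T → Fin N → Fin K) → ℝ) : Prop :=
  ∀ a b, (∀ t : Fin T, blockOf B t < τ → a t = b t) → H a = H b

theorem trajExp_action (hA : IsCausal A) (hΔ : ∀ Z τ, A Z τ ∈ stdSimplex ℝ (Fin K)) (hK : 0 < K)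
    (t : Fin T) (i : Fin N) (φ : Fin K → ℝ) :
    trajExp G W κ B A ℓ (fun a => φ (a t i)) =
      trajExp G W κ B A ℓ (fun a => ∑ k, policy G W κ B A ℓ a (blockOf B t) i k * φ k) := by
  rw [← sub_eq_zero, ← trajExp_sub]
  refine trajExp_eq_zero hA hΔ hK t i (Ψ := fun a x => φ x -
    ∑ k, policy G W κ B A ℓ a (blockOf B t) i k * φ k) ?_ ?_
  · intro a b x h
    rw [policy_congr (a := a) (b := b) (blockOf B t) fun s hs => funext fun j => h s j
      (fun e => by rw [Prod.mk.injEq] at e; rw [e.1] at hs; exact lt_irrefl _ hs) hs.le]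
  · intro a
    simp only [mul_sub, Finset.sum_sub_distrib, ← Finset.sum_mul, sum_policy hA hΔ hK, one_mul,
      sub_self]

theorem policy_congr_of_ne {a b : Fin T → Fin N → Fin K} {t : Fin T} {i : Fin N} {τ : ℕ}
    (hτ : τ ≤ blockOf B t)
    (h : ∀ s j, (s, j) ≠ (t, i) → blockOf B s ≤ blockOf B t → a s j = b s j) :
    ∀ s : Fin T, blockOf B s < τ → a s = b s := fun s hs => funext fun j =>
  h s j (fun e => by rw [Prod.mk.injEq] at e; rw [e.1] at hs; omega) (by omega)

/-- Unbiasedness of importance weighting. The weight `H` may depend on other actions of the same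
block, which is what the cross terms of the variance require. -/
theorem trajExp_roundEstimate (hA : IsCausal A) (hΔ : ∀ Z τ, A Z τ ∈ stdSimplex ℝ (Fin K))
    (hK : 0 < K) (hT : 0 < T) (v : Fin T × Fin N) (k : Fin K)
    {H : (Fin T → Fin N → Fin K) → ℝ}
    (hH : ∀ a b, (∀ s j, (s, j) ≠ v → blockOf B s ≤ blockOf B v.1 → a s j = b s j) → H a = H b) :
    trajExp G W κ B A ℓ (fun a => H a * (roundEstimate G W κ B A ℓ a v k - ℓ v.1 v.2 k)) = 0 := by
  obtain ⟨t, i⟩ := v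
  refine trajExp_eq_zero hA hΔ hK t i (Ψ := fun a x => H a * ((if x = k then
    ℓ t i k / policy G W κ B A ℓ a (blockOf B t) i k else 0) - ℓ t i k)) ?_ ?_
  · intro a b x h
    rw [policy_congr (a := a) (b := b) (blockOf B t) (policy_congr_of_ne le_rfl h), hH a b h]
  · intro a
    have hp := (policy_pos (G := G) (W := W) (κ := κ) (B := B) (ℓ := ℓ) hA hΔ hK hT a
      (blockOf B t) i k).ne'
    have h1 : ∀ x, policy G W κ B A ℓ a (blockOf B t) i x * (H a * ((if x = k then
        ℓ t i k / policy G W κ B A ℓ a (blockOf B t) i k else 0) - ℓ t i k)) =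
        H a * ((if x = k then ℓ t i k else 0) -
          policy G W κ B A ℓ a (blockOf B t) i x * ℓ t i k) := by
      intro x
      split_ifs with hx
      · rw [hx]; field_simp
      · ring
    simp only [h1, ← Finset.mul_sum, Finset.sum_sub_distrib, ← Finset.sum_mul,
      sum_policy hA hΔ hK]
    simp

/-- The conditional variance is `ℓ²/p - ℓ²`, and `ℓ² ≤ ℓ` on `[0, 1]`. Keeping one factor `ℓ` leads
to a small-loss bound. -/
theorem trajExp_roundEstimate_sq_le (hA : IsCausal A)
    (hΔ : ∀ Z τ, A Z τ ∈ stdSimplex ℝ (Fin K))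
    (hK : 0 < K) (hT : 0 < T) (hℓ : ∀ t i k, ℓ t i k ∈ Set.Icc (0 : ℝ) 1)
    (v : Fin T × Fin N) (k : Fin K)
    {H : (Fin T → Fin N → Fin K) → ℝ} (hH : IsPredictable B (blockOf B v.1) H)
    (hH0 : ∀ a, 0 ≤ H a) :
    trajExp G W κ B A ℓ (fun a => H a * (roundEstimate G W κ B A ℓ a v k - ℓ v.1 v.2 k) ^ 2) ≤
      trajExp G W κ B A ℓ
        (fun a => H a * (ℓ v.1 v.2 k / policy G W κ B A ℓ a (blockOf B v.1) v.2 k)) := by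
  obtain ⟨t, i⟩ := v
  have h0 : trajExp G W κ B A ℓ (fun a => H a * (roundEstimate G W κ B A ℓ a (t, i) k ^ 2 -
      ℓ t i k ^ 2 / policy G W κ B A ℓ a (blockOf B t) i k)) = 0 := by
    refine trajExp_eq_zero hA hΔ hK t i (Ψ := fun a x => H a * ((if x = k then
      ℓ t i k / policy G W κ B A ℓ a (blockOf B t) i k else 0) ^ 2 -
        ℓ t i k ^ 2 / policy G W κ B A ℓ a (blockOf B t) i k)) ?_ ?_
    · intro a b x h
      have hh := policy_congr_of_ne le_rfl h
      rw [policy_congr (a := a) (b := b) (blockOf B t) hh, hH a b hh]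
    · intro a
      have hp := (policy_pos (G := G) (W := W) (κ := κ) (B := B) (ℓ := ℓ) hA hΔ hK hT a
        (blockOf B t) i k).ne'
      have h1 : ∀ x, policy G W κ B A ℓ a (blockOf B t) i x * (H a * ((if x = k then
          ℓ t i k / policy G W κ B A ℓ a (blockOf B t) i k else 0) ^ 2 -
            ℓ t i k ^ 2 / policy G W κ B A ℓ a (blockOf B t) i k)) =
          H a * ((if x = k then ℓ t i k ^ 2 / policy G W κ B A ℓ a (blockOf B t) i k else 0) -
            policy G W κ B A ℓ a (blockOf B t) i x *
              (ℓ t i k ^ 2 / policy G W κ B A ℓ a (blockOf B t) i k)) := by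
        intro x
        split_ifs with hx
        · rw [hx]; field_simp
        · ring
      simp only [h1, ← Finset.mul_sum, Finset.sum_sub_distrib, ← Finset.sum_mul,
        sum_policy hA hΔ hK]
      simp
  have h1 := trajExp_roundEstimate (G := G) (W := W) (κ := κ) (ℓ := ℓ) hA hΔ hK hT (t, i) k
    (H := H) (fun a b h => hH a b (policy_congr_of_ne le_rfl h))
  have h2 : trajExp G W κ B A ℓ (fun a => H a * (roundEstimate G W κ B A ℓ a (t, i) k ^ 2 -
      ℓ t i k ^ 2 / policy G W κ B A ℓ a (blockOf B t) i k) -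
      2 * ℓ t i k * (H a * (roundEstimate G W κ B A ℓ a (t, i) k - ℓ t i k))) = 0 := by
    rw [trajExp_sub, trajExp_const_mul, h0, h1]; ring
  -- Subtracting this centred quantity turns the squared error pointwise into `H (ℓ²/p - ℓ²)`.
  rw [← sub_zero (trajExp G W κ B A ℓ _), ← h2, ← trajExp_sub]
  refine trajExp_mono hA hΔ hK hT fun a => ?_
  have hp := policy_pos (G := G) (W := W) (κ := κ) (B := B) (ℓ := ℓ) hA hΔ hK hT a
        (blockOf B t) i k
  have h3 : ℓ t i k ^ 2 / policy G W κ B A ℓ a (blockOf B t) i k ≤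
      ℓ t i k / policy G W κ B A ℓ a (blockOf B t) i k := by
    have := hℓ t i k
    gcongr
    nlinarith [this.1, this.2]
  have h4 := mul_le_mul_of_nonneg_left h3 (hH0 a)
  have h5 := mul_nonneg (hH0 a) (sq_nonneg (ℓ t i k))
  simp only
  linarith

theorem trajExp_meanEstimate (hA : IsCausal A) (hΔ : ∀ Z τ, A Z τ ∈ stdSimplex ℝ (Fin K))
    (hK : 0 < K) (hT : 0 < T) (τ : ℕ) (k : Fin K)
    {H : (Fin T → Fin N → Fin K) → ℝ} (hH : IsPredictable B τ H) :
    trajExp G W κ B A ℓ (fun a => H a * meanEstimate G W κ B A ℓ a τ k) =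
      trajExp G W κ B A ℓ (fun a => H a * blockLoss B ℓ τ k) := by
  rw [← sub_eq_zero, ← trajExp_sub]
  have h1 : ∀ a, H a * meanEstimate G W κ B A ℓ a τ k - H a * blockLoss B ℓ τ k =
      1 / (N : ℝ) * ∑ v ∈ blockRounds T B τ ×ˢ Finset.univ,
        H a * (roundEstimate G W κ B A ℓ a v k - ℓ v.1 v.2 k) := by
    intro a
    rw [meanEstimate_eq, blockLoss_eq, ← Finset.mul_sum, Finset.sum_sub_distrib]; ring
  simp only [h1]
  rw [trajExp_const_mul, trajExp_sum, Finset.sum_eq_zero, mul_zero]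
  intro v hv
  have hv' := mem_blockRounds.1 (Finset.mem_product.1 hv).1
  exact trajExp_roundEstimate hA hΔ hK hT v k
    fun a b h => hH a b (policy_congr_of_ne hv'.ge h)

/-- Errors of distinct pairs in a block are uncorrelated, so the variance of the mean is `1/N²`
times a sum of individual variances; this is the gain from cooperation. -/
theorem trajExp_meanEstimate_sq_le (hA : IsCausal A) (hΔ : ∀ Z τ, A Z τ ∈ stdSimplex ℝ (Fin K))
    (hK : 0 < K) (hT : 0 < T) (hℓ : ∀ t i k, ℓ t i k ∈ Set.Icc (0 : ℝ) 1) (τ : ℕ) (k : Fin K)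
    {H : (Fin T → Fin N → Fin K) → ℝ} (hH : IsPredictable B τ H) (hH0 : ∀ a, 0 ≤ H a) :
    trajExp G W κ B A ℓ
        (fun a => H a * (meanEstimate G W κ B A ℓ a τ k - blockLoss B ℓ τ k) ^ 2) ≤
      trajExp G W κ B A ℓ (fun a => H a * (1 / (N : ℝ) ^ 2 *
        ∑ v ∈ blockRounds T B τ ×ˢ Finset.univ,
          ℓ v.1 v.2 k / policy G W κ B A ℓ a τ v.2 k)) := by
  set s := blockRounds T B τ ×ˢ (Finset.univ : Finset (Fin N)) with hs
  have hmem : ∀ v ∈ s, blockOf B v.1 = τ := fun v hv =>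
    mem_blockRounds.1 (Finset.mem_product.1 hv).1
  have h1 : ∀ a, H a * (meanEstimate G W κ B A ℓ a τ k - blockLoss B ℓ τ k) ^ 2 =
      1 / (N : ℝ) ^ 2 * ∑ v ∈ s, ∑ w ∈ s,
        H a * (roundEstimate G W κ B A ℓ a w k - ℓ w.1 w.2 k) *
          (roundEstimate G W κ B A ℓ a v k - ℓ v.1 v.2 k) := by
    intro a
    rw [meanEstimate_eq, blockLoss_eq, ← mul_sub, ← Finset.sum_sub_distrib, mul_pow,
      sq (∑ v ∈ s, _), Finset.sum_mul_sum]
    simp only [Finset.mul_sum]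
    refine Finset.sum_congr rfl fun v _ => Finset.sum_congr rfl fun w _ => ?_
    ring
  have h2 : ∀ a, H a * (1 / (N : ℝ) ^ 2 * ∑ v ∈ s, ℓ v.1 v.2 k / policy G W κ B A ℓ a τ v.2 k) =
      1 / (N : ℝ) ^ 2 * ∑ v ∈ s,
        H a * (ℓ v.1 v.2 k / policy G W κ B A ℓ a τ v.2 k) := by
    intro a
    rw [← Finset.mul_sum]; ring
  simp only [h1, h2]
  rw [trajExp_const_mul, trajExp_const_mul, trajExp_sum, trajExp_sum]
  refine mul_le_mul_of_nonneg_left (Finset.sum_le_sum fun v hv => ?_) (by positivity)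
  rw [trajExp_sum, Finset.sum_eq_single v]
  · have h3 := trajExp_roundEstimate_sq_le (G := G) (W := W) (κ := κ) hA hΔ hK hT hℓ v k
      (H := H) (by rw [hmem v hv]; exact hH) hH0
    rw [hmem v hv] at h3
    simpa only [sq, mul_assoc] using h3
  -- Off-diagonal terms vanish: the error at `w` is an admissible weight for the centred error at
  -- `v`.
  · intro w hw hwv
    refine trajExp_roundEstimate hA hΔ hK hT v k fun a b h => ?_
    have hh : ∀ t : Fin T, blockOf B t < τ → a t = b t :=
      policy_congr_of_ne (t := v.1) (i := v.2) (hmem v hv).ge h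
    rw [hH a b hh, roundEstimate, roundEstimate, hmem w hw, policy_congr τ hh,
      h w.1 w.2 hwv (by rw [hmem v hv, hmem w hw])]
  · exact fun h => absurd hv h

end Estimates

/-! ### The regret of the distributed algorithm -/

section Delayed

variable {K : ℕ}

/-- In block `τ` the queried copy uses feedback up to its previous block `τ - 2`, which is delivered
at the end of block `τ - 1`. -/
theorem isCausal_delayed_ftrl (ψ : ℕ → (Fin K → ℝ) → EReal) : IsCausal (delayed (ftrl ψ)) := by
  intro Z Z' τ h
  simp only [delayed, ftrl]
  split_ifs with hs
  · rfl
  · congr 1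
    funext k
    refine Finset.sum_congr rfl fun r hr => ?_
    rw [Finset.mem_Icc] at hr
    rw [h _ (by omega) (by omega)]

theorem delayed_ftrl_mem (hK : 0 < K) {η γ : ℝ} (hη : 0 < η) (hγ : 0 < γ) (Z : ℕ → Fin K → ℝ)
    (τ : ℕ) : delayed (ftrl fun _ => hybridReg η γ) Z τ ∈ stdSimplex ℝ (Fin K) := by
  rw [delayed]
  rcases Nat.eq_zero_or_pos ((τ + 1) / 2) with h | h
  · rw [h]
    exact (isFtrlOpt_uniform hK η γ).mem
  · obtain ⟨s, hs⟩ := Nat.exists_eq_succ_of_ne_zero h.ne'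
    rw [hs]
    exact (isFtrlOpt_ftrl hK hη hγ _ s).mem

/-- The block in which the copy `r` of the base learner is queried for the `(m+1)`-st time. -/
def copyBlock (r m : ℕ) : ℕ := 2 * (m + 1) - r

theorem isFtrlOpt_delayed (hK : 0 < K) {η γ : ℝ} (hη : 0 < η) (hγ : 0 < γ)
    (Z : ℕ → Fin K → ℝ) {r : ℕ} (hr : r < 2) (s : ℕ) :
    IsFtrlOpt η γ (fun k => ∑ m ∈ Finset.range s, Z (copyBlock r m + 1) k)
      (delayed (ftrl fun _ => hybridReg η γ) Z (copyBlock r s)) := by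
  have h1 : copyBlock r s % 2 = r := by unfold copyBlock; omega
  have h2 : (copyBlock r s + 1) / 2 = s + 1 := by unfold copyBlock; omega
  rw [delayed, h1, h2]
  exact isFtrlOpt_ftrl hK hη hγ (fun s => Z (2 * s - r + 1)) s

theorem copyBlock_zero_query {η γ : ℝ} (Z : ℕ → Fin K → ℝ) {r : ℕ} (hr : r < 2) :
    delayed (ftrl fun _ => hybridReg η γ) Z (copyBlock r 0) = fun _ => 1 / (K : ℝ) := by
  have h2 : (copyBlock r 0 + 1) / 2 = 1 := by unfold copyBlock; omega
  rw [delayed, h2]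
  simp [ftrl]

/-- Parity and half-index determine a block. Block numbers do not exceed `T`, so `T` queries per
copy cover all rounds; surplus blocks are empty. -/
theorem sum_copyBlock {T B : ℕ} (F : Fin T → ℝ) :
    ∑ r ∈ Finset.range 2, ∑ m ∈ Finset.range T, ∑ t ∈ blockRounds T B (copyBlock r m), F t =
      ∑ t, F t := by
  rw [← Finset.sum_product' (f := fun r m => ∑ t ∈ blockRounds T B (copyBlock r m), F t)]
  rw [← Finset.sum_fiberwise_of_maps_to (s := Finset.univ)
    (t := Finset.range 2 ×ˢ Finset.range T)
    (g := fun t : Fin T => (blockOf B t % 2, (blockOf B t + 1) / 2 - 1))]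
  · refine Finset.sum_congr rfl fun p hp => Finset.sum_congr ?_ fun _ _ => rfl
    rw [Finset.mem_product, Finset.mem_range, Finset.mem_range] at hp
    ext t
    rw [mem_blockRounds, Finset.mem_filter, Prod.ext_iff]
    simp only [Finset.mem_univ, true_and, copyBlock, blockOf]
    generalize t.val / B = x
    omega
  · intro t _
    have := Nat.div_le_self t.val B
    have := t.isLt
    simp only [Finset.mem_product, Finset.mem_range, blockOf]
    omega

end Delayed

/-! ### Bounds on the losses and estimates of a block -/

section Blocks

variable {N K T B : ℕ} {ℓ : Fin T → Fin N → Fin K → ℝ}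

theorem avgLoss_mem (hN : 0 < N) (hℓ : ∀ t i k, ℓ t i k ∈ Set.Icc (0 : ℝ) 1) (t : Fin T)
    (k : Fin K) : avgLoss ℓ t k ∈ Set.Icc (0 : ℝ) 1 := by
  have h0 : 0 ≤ ∑ j, ℓ t j k := Finset.sum_nonneg fun j _ => (hℓ t j k).1
  have h1 : ∑ j, ℓ t j k ≤ N := by
    calc ∑ j, ℓ t j k ≤ ∑ _j : Fin N, (1 : ℝ) := Finset.sum_le_sum fun j _ => (hℓ t j k).2
      _ = N := by simp
  rw [avgLoss, one_div_mul_eq_div]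
  exact ⟨by positivity, by rw [div_le_one (by positivity)]; exact h1⟩

theorem card_blockRounds_le (hB : 0 < B) (τ : ℕ) : (blockRounds T B τ).card ≤ B := by
  have h1 : (blockRounds T B τ).map Fin.valEmbedding ⊆
      Finset.Ico ((τ - 1) * B) ((τ - 1) * B + B) := by
    intro x hx
    rw [Finset.mem_map] at hx
    obtain ⟨t, ht, rfl⟩ := hx
    have h2 : t.val / B = τ - 1 := by
      rw [← mem_blockRounds.1 ht]
      rfl
    rw [Finset.mem_Ico, ← h2, Fin.valEmbedding_apply]
    exact ⟨Nat.div_mul_le_self _ _, Nat.lt_div_mul_add hB⟩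
  have h3 := Finset.card_le_card h1
  rw [Finset.card_map, Nat.card_Ico] at h3
  omega

theorem blockLoss_nonneg (hN : 0 < N) (hℓ : ∀ t i k, ℓ t i k ∈ Set.Icc (0 : ℝ) 1) (τ : ℕ)
    (k : Fin K) : 0 ≤ blockLoss B ℓ τ k :=
  Finset.sum_nonneg fun t _ => (avgLoss_mem hN hℓ t k).1

theorem blockLoss_le (hN : 0 < N) (hB : 0 < B) (hℓ : ∀ t i k, ℓ t i k ∈ Set.Icc (0 : ℝ) 1) (τ : ℕ)
    (k : Fin K) : blockLoss B ℓ τ k ≤ B := by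
  calc blockLoss B ℓ τ k ≤ ∑ _t ∈ blockRounds T B τ, (1 : ℝ) :=
        Finset.sum_le_sum fun t _ => (avgLoss_mem hN hℓ t k).2
    _ ≤ B := by
        simp only [Finset.sum_const, nsmul_eq_mul, mul_one]
        exact_mod_cast card_blockRounds_le hB τ

/-- At most `T` rounds, each with inverse probability at most `T K`; this crude size is what the
logarithm in the block length has to overcome. -/
theorem blockEstimate_mem (hK : 0 < K) (hT : 0 < T)
    (hℓ : ∀ t i k, ℓ t i k ∈ Set.Icc (0 : ℝ) 1)
    (a : Fin T → Fin N → Fin K) (τ : ℕ) {p : Fin N → Fin K → ℝ}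
    (hp : ∀ i k, 1 / ((T : ℝ) * K) ≤ p i k) (i : Fin N) (k : Fin K) :
    blockEstimate B ℓ a τ p i k ∈ Set.Icc (0 : ℝ) ((T : ℝ) ^ 2 * K) := by
  have hp0 : ∀ i k, 0 < p i k := fun i k => lt_of_lt_of_le (by positivity) (hp i k)
  constructor
  · refine Finset.sum_nonneg fun t _ => ?_
    split_ifs
    · exact div_nonneg (hℓ t i k).1 (hp0 i k).le
    · exact le_rfl
  · calc blockEstimate B ℓ a τ p i k ≤ ∑ _t ∈ (Finset.univ : Finset (Fin T)).filter
          (fun t => blockOf B t.val = τ), ((T : ℝ) * K) := by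
          refine Finset.sum_le_sum fun t _ => ?_
          split_ifs
          · rw [div_le_iff₀ (hp0 i k)]
            have := mul_le_mul_of_nonneg_left (hp i k) (by positivity : 0 ≤ (T : ℝ) * K)
            rw [mul_one_div_cancel (by positivity)] at this
            exact (hℓ t i k).2.trans this
          · positivity
      _ ≤ (T : ℝ) * (T * K) := by
          rw [Finset.sum_const, nsmul_eq_mul]
          have : (((Finset.univ : Finset (Fin T)).filter
            (fun t => blockOf B t.val = τ)).card : ℝ) ≤ T := by
            exact_mod_cast (Finset.card_le_univ _).trans (by simp)
          gcongr
      _ = (T : ℝ) ^ 2 * K := by ring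

end Blocks

/-! ### Regret of one copy of the base learner -/

section Regret

variable {N K T : ℕ} {G : SimpleGraph (Fin N)} {W : Matrix (Fin N) (Fin N) ℝ}
  {ℓ : Fin T → Fin N → Fin K → ℝ} {η γ : ℝ}

/-- The delivered vectors approximate the mean estimates. -/
theorem abs_deliver_sub_meanEstimate_le (hN : 0 < N) (hW : IsGossipMatrix G W)
    (hσ : sigma2 W < 1) (hK : 0 < K) (hT : 0 < T) (hB : blockLength K T W ≤ T)
    {A : Learner K} (hA : IsCausal A) (hΔ : ∀ Z τ, A Z τ ∈ stdSimplex ℝ (Fin K))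
    (hℓ : ∀ t i k, ℓ t i k ∈ Set.Icc (0 : ℝ) 1) (a : Fin T → Fin N → Fin K) (τ : ℕ)
    (i : Fin N) (k : Fin K) :
    |deliver G W (mixing W) (blockLength K T W) A ℓ a (τ + 1) i k -
      meanEstimate G W (mixing W) (blockLength K T W) A ℓ a τ k| ≤
        1 / ((K : ℝ) ^ 5 * T ^ 3) := by
  refine abs_gossip_blockLength_sub_mean_le hN hW hσ hK hT hB (fun j k => ?_) i k
  have := blockEstimate_mem (B := blockLength K T W) hK hT hℓ a τ
    (policy_lower (G := G) (W := W) (κ := mixing W) (B := blockLength K T W) (ℓ := ℓ)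
      hA hΔ hT a τ) j k
  rw [Nat.add_sub_cancel, abs_of_nonneg this.1]
  exact this.2

theorem isFtrlOpt_learnerOut (hK : 0 < K) (hη : 0 < η) (hγ : 0 < γ) {κ : ℝ} {B : ℕ}
    {A : Learner K} (hAdef : A = delayed (ftrl fun _ => hybridReg η γ))
    (a : Fin T → Fin N → Fin K) {r : ℕ} (hr : r < 2) (m : ℕ) (i : Fin N) :
    IsFtrlOpt η γ
      (fun k => ∑ n ∈ Finset.range m, deliver G W κ B A ℓ a (copyBlock r n + 1) i k)
      (learnerOut G W κ B A ℓ a (copyBlock r m) i) := by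
  have := isFtrlOpt_delayed (η := η) (γ := γ) hK hη hγ
    (fun σ => deliver G W κ B A ℓ a σ i) hr m
  rw [learnerOut]
  rw [← hAdef] at this
  exact this

/-- All agents play similar distributions. -/
theorem policy_ge_learnerOut (hN : 0 < N) (hW : IsGossipMatrix G W)
    (hσ : sigma2 W < 1) (hK : 2 ≤ K) (hT : 3 ≤ T)
    {B : ℕ} (hBdef : B = blockLength K T W) (hB : B ≤ T)
    (hη : 0 < η) (hη1 : η ≤ 1 / 4) (hγ : 0 < γ)
    {A : Learner K} (hAdef : A = delayed (ftrl fun _ => hybridReg η γ))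
    (hℓ : ∀ t i k, ℓ t i k ∈ Set.Icc (0 : ℝ) 1) (a : Fin T → Fin N → Fin K)
    {r m : ℕ} (hr : r < 2) (hm : m ≤ T) (i j : Fin N) (k : Fin K) :
    2 / 3 * learnerOut G W (mixing W) B A ℓ a (copyBlock r m) i k ≤
      policy G W (mixing W) B A ℓ a (copyBlock r m) j k := by
  have hK0 : 0 < K := by omega
  have hT0 : 0 < T := by omega
  have hA : IsCausal A := hAdef ▸ isCausal_delayed_ftrl _
  have hΔ : ∀ Z τ, A Z τ ∈ stdSimplex ℝ (Fin K) := hAdef ▸ delayed_ftrl_mem hK0 hη hγ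
  rw [policy_eq hA]
  have hopt := fun i => isFtrlOpt_learnerOut (G := G) (W := W) (ℓ := ℓ) (κ := mixing W) (B := B)
    hK0 hη hγ hAdef a hr m i
  have hdel : ∀ n i k, |deliver G W (mixing W) B A ℓ a (copyBlock r n + 1) i k -
      meanEstimate G W (mixing W) B A ℓ a (copyBlock r n) k| ≤ 1 / ((K : ℝ) ^ 5 * T ^ 3) := by
    rw [hBdef] at hB ⊢
    exact fun n => abs_deliver_sub_meanEstimate_le hN hW hσ hK0 hT0 hB hA hΔ hℓ a (copyBlock r n)
  have hqi0 : 0 ≤ learnerOut G W (mixing W) B A ℓ a (copyBlock r m) i k := (hΔ _ _).1 k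
  generalize learnerOut G W (mixing W) B A ℓ a (copyBlock r m) = q at hopt hqi0
  generalize deliver G W (mixing W) B A ℓ a = d at hopt hdel
  generalize meanEstimate G W (mixing W) B A ℓ a = x at hdel
  have hKr : (2 : ℝ) ≤ K := by exact_mod_cast hK
  have hTr : (3 : ℝ) ≤ T := by exact_mod_cast hT
  have h13 : 1 / (T : ℝ) ≤ 1 / 3 := by gcongr
  have hT0' : 0 < 1 / (T : ℝ) := by positivity
  -- At most `T` deliveries, each differing between two agents by at most `2/(K⁵T³)`, give `δ =
  -- 2/(K⁵T²)`; with `η ≤ 1/4` the squared gap is at most `2 δ η ≤ 1/(K⁵T²) ≤ (1/(TK))²`.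
  have key : q i k - q j k ≤ 1 / (T * K) := by
    rcases le_total (q i k) (q j k) with h | h
    · have : 0 ≤ 1 / ((T : ℝ) * K) := by positivity
      linarith
    · have h1 := (hopt i).sq_sub_le (δ := 2 / (K ^ 5 * T ^ 2)) hη hγ (hopt j) (fun k => by
        rw [← Finset.sum_sub_distrib]
        refine (Finset.abs_sum_le_sum_abs _ _).trans ?_
        have h2 : ∀ n ∈ Finset.range m,
            |d (copyBlock r n + 1) i k -
            d (copyBlock r n + 1) j k| ≤
              2 * (1 / ((K : ℝ) ^ 5 * T ^ 3)) := fun n _ => by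
          have e1 := hdel n i k
          have e2 := hdel n j k
          rw [abs_le] at e1 e2 ⊢
          constructor <;> linarith [e1.1, e1.2, e2.1, e2.2]
        refine (Finset.sum_le_sum h2).trans ?_
        rw [Finset.sum_const, Finset.card_range, nsmul_eq_mul]
        have hm' : (m : ℝ) ≤ T := by exact_mod_cast hm
        calc (m : ℝ) * (2 * (1 / ((K : ℝ) ^ 5 * T ^ 3)))
            ≤ T * (2 * (1 / ((K : ℝ) ^ 5 * T ^ 3))) := by gcongr
          _ = 2 / ((K : ℝ) ^ 5 * T ^ 2) := by field_simp) h
      refine le_of_sq_le_sq (h1.trans ?_) (by positivity)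
      calc 2 * (2 / ((K : ℝ) ^ 5 * T ^ 2)) * η ≤ 2 * (2 / ((K : ℝ) ^ 5 * T ^ 2)) * (1 / 4) := by
            gcongr
        _ = 1 / ((K : ℝ) ^ 5 * T ^ 2) := by ring
        _ ≤ 1 / ((K : ℝ) ^ 2 * T ^ 2) := by
            gcongr
            · linarith
            · norm_num
        _ = (1 / ((T : ℝ) * K)) ^ 2 := by rw [div_pow, mul_pow, one_pow, mul_comm]
  rw [div_mul_div_comm, one_mul]
  -- The exploration mass `1/(TK)` makes up for the additive gap; what is left is the factor `1 -
  -- 1/T ≥ 2/3`.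
  have h1 : (1 - 1 / (T : ℝ)) * (q i k - 1 / (T * K)) ≤ (1 - 1 / (T : ℝ)) * q j k :=
    mul_le_mul_of_nonneg_left (by linarith) (by linarith)
  have h2 : 0 ≤ 1 / (T : ℝ) * (1 / (T * K)) := by positivity
  nlinarith

/-- The regret of one copy of the base learner on one trajectory. -/
theorem copy_regret_le (hN : 0 < N) (hW : IsGossipMatrix G W)
    (hσ : sigma2 W < 1) (hK : 0 < K) (hT : 0 < T)
    {B : ℕ} (hBdef : B = blockLength K T W) (hB : B ≤ T)
    (hη : 0 < η) (hγ : 0 < γ)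
    {A : Learner K} (hAdef : A = delayed (ftrl fun _ => hybridReg η γ))
    (hℓ : ∀ t i k, ℓ t i k ∈ Set.Icc (0 : ℝ) 1) (a : Fin T → Fin N → Fin K)
    {r : ℕ} (hr : r < 2) (i : Fin N)
    {u : Fin K → ℝ} (hu : u ∈ stdSimplex ℝ (Fin K)) (huT : ∀ k, 1 / ((T : ℝ) * K) ≤ u k)
    {q y c : ℕ → Fin K → ℝ}
    (hq : ∀ m, q m = learnerOut G W (mixing W) B A ℓ a (copyBlock r m) i)
    (hy : ∀ m, y m = meanEstimate G W (mixing W) B A ℓ a (copyBlock r m)) :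
    ∑ m ∈ Finset.range T, ∑ k, (q m k - u k) * y m k ≤
      Real.log K / η + K * Real.log T / γ + ∑ m ∈ Finset.range T,
        (∑ k, (η / 2 * (q m k * c m k ^ 2) + γ / 2 * (q m k ^ 2 * (y m k - c m k) ^ 2)) +
          4 * (1 / ((K : ℝ) ^ 5 * T ^ 3))) := by
  have hA : IsCausal A := hAdef ▸ isCausal_delayed_ftrl _
  have hΔ : ∀ Z τ, A Z τ ∈ stdSimplex ℝ (Fin K) := hAdef ▸ delayed_ftrl_mem hK hη hγ
  have hopt : ∀ m, IsFtrlOpt η γ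
      (fun k => ∑ n ∈ Finset.range m,
        deliver G W (mixing W) B A ℓ a (copyBlock r n + 1) i k) (q m) := fun m => by
    rw [hq]
    exact isFtrlOpt_learnerOut hK hη hγ hAdef a hr m i
  have hy0 : ∀ m k, 0 ≤ y m k := fun m k => by
    rw [hy]
    exact div_nonneg (Finset.sum_nonneg fun j _ => (blockEstimate_mem hK hT hℓ a _
      (policy_lower hA hΔ hT a _) j k).1) (Nat.cast_nonneg N)
  have hdel : ∀ m k, |deliver G W (mixing W) B A ℓ a (copyBlock r m + 1) i k - y m k| ≤
      1 / ((K : ℝ) ^ 5 * T ^ 3) := fun m k => by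
    rw [hy]
    rw [hBdef] at hB ⊢
    exact abs_deliver_sub_meanEstimate_le hN hW hσ hK hT hB hA hΔ hℓ a (copyBlock r m) i k
  have h1 := ftrl_regret_le_of_approx (y := y) (c := c) hη hγ hopt hy0 hdel hu
    (fun k => lt_of_lt_of_le (by positivity) (huT k)) T
  have h2 : q 0 = fun _ => 1 / (K : ℝ) := by
    rw [hq, hAdef]
    exact copyBlock_zero_query _ hr
  rw [h2] at h1
  have h3 := hybridVal_sub_uniform_le hK hη hγ (T := T) (by positivity) hu huT
  linarith

/-- The regret of one copy of the base learner in expectation. -/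
theorem copy_expected_regret_le (hN : 0 < N) (hW : IsGossipMatrix G W)
    (hσ : sigma2 W < 1) (hK : 2 ≤ K) (hT : 3 ≤ T)
    {B : ℕ} (hBdef : B = blockLength K T W) (hB0 : 0 < B) (hB : B ≤ T)
    (hη : 0 < η) (hη1 : η ≤ 1 / 4) (hγ : 0 < γ)
    (hℓ : ∀ t i k, ℓ t i k ∈ Set.Icc (0 : ℝ) 1)
    {r : ℕ} (hr : r < 2) (i : Fin N)
    {u : Fin K → ℝ} (hu : u ∈ stdSimplex ℝ (Fin K)) (huT : ∀ k, 1 / ((T : ℝ) * K) ≤ u k)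
    {A : Learner K} (hAdef : A = delayed (ftrl fun _ => hybridReg η γ)) {V : ℕ → ℝ}
    (hV : ∀ m, V m = trajExp G W (mixing W) B A ℓ
      (fun a => ∑ k, learnerOut G W (mixing W) B A ℓ a (copyBlock r m) i k *
        blockLoss B ℓ (copyBlock r m) k)) :
    ∑ m ∈ Finset.range T, (V m - ∑ k, u k * blockLoss B ℓ (copyBlock r m) k) ≤
      Real.log K / η + K * Real.log T / γ +
        (η * B / 2 + 3 * γ / (4 * N)) * ∑ m ∈ Finset.range T, V m +
        4 * (1 / ((K : ℝ) ^ 5 * T ^ 2)) := by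
  have hK0 : 0 < K := by omega
  have hT0 : 0 < T := by omega
  have hA : IsCausal A := hAdef ▸ isCausal_delayed_ftrl _
  have hΔ : ∀ Z τ, A Z τ ∈ stdSimplex ℝ (Fin K) := hAdef ▸ delayed_ftrl_mem hK0 hη hγ
  set q := fun (a : Fin T → Fin N → Fin K) m =>
    learnerOut G W (mixing W) B A ℓ a (copyBlock r m) i with hq
  set y := fun (a : Fin T → Fin N → Fin K) m =>
    meanEstimate G W (mixing W) B A ℓ a (copyBlock r m) with hy
  -- The free centre of the stability bound is taken to be the conditional mean of `y`, so that `y -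
  -- c` has only its variance left.
  set c := fun m => blockLoss B ℓ (copyBlock r m) with hc
  have hq0 : ∀ a m k, 0 ≤ q a m k := fun a m k => (hΔ _ _).1 k
  have hqpred : ∀ m k, IsPredictable B (copyBlock r m) fun a => q a m k := fun m k a b h => by
    simp only [hq]
    rw [learnerOut_congr hA _ h]
  set E := trajExp G W (mixing W) B A ℓ with hE
  have hpath : ∀ a, ∑ m ∈ Finset.range T, ∑ k, (q a m k - u k) * y a m k ≤
      Real.log K / η + K * Real.log T / γ + ∑ m ∈ Finset.range T,
        (∑ k, (η / 2 * (q a m k * c m k ^ 2) + γ / 2 * (q a m k ^ 2 * (y a m k - c m k) ^ 2)) +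
          4 * (1 / ((K : ℝ) ^ 5 * T ^ 3))) := by
    intro a
    exact copy_regret_le hN hW hσ hK0 hT0 hBdef hB hη hγ hAdef hℓ a hr i hu huT
      (fun _ => rfl) (fun _ => rfl)
  have h1 := trajExp_mono (G := G) (W := W) (κ := mixing W) (B := B) (ℓ := ℓ) hA hΔ hK0 hT0 hpath
  rw [trajExp_sum, trajExp_add, trajExp_const hA hΔ hK0, trajExp_sum] at h1
  have hleft : ∀ m, E (fun a => ∑ k, (q a m k - u k) * y a m k) = V m - ∑ k, u k * c m k := by
    intro m
    rw [hE, trajExp_sum]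
    have : ∀ k, trajExp G W (mixing W) B A ℓ (fun a => (q a m k - u k) * y a m k) =
        trajExp G W (mixing W) B A ℓ (fun a => (q a m k - u k) * c m k) := fun k =>
      trajExp_meanEstimate hA hΔ hK0 hT0 (copyBlock r m) k (H := fun a => q a m k - u k)
        (fun a b h => by simp only [hqpred m k a b h])
    simp only [this]
    rw [← trajExp_sum, hV m, ← trajExp_const (G := G) (W := W) (κ := mixing W) (B := B) (ℓ := ℓ)
      hA hΔ hK0 (∑ k, u k * c m k), ← trajExp_sub]
    congr 1
    funext a
    rw [← Finset.sum_sub_distrib]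
    exact Finset.sum_congr rfl fun k _ => by ring
  have hright : ∀ m ∈ Finset.range T, E (fun a => ∑ k, (η / 2 * (q a m k * c m k ^ 2) +
      γ / 2 * (q a m k ^ 2 * (y a m k - c m k) ^ 2)) + 4 * (1 / ((K : ℝ) ^ 5 * T ^ 3))) ≤
      (η * B / 2 + 3 * γ / (4 * N)) * V m + 4 * (1 / ((K : ℝ) ^ 5 * T ^ 3)) := by
    intro m hm
    rw [Finset.mem_range] at hm
    rw [hE, trajExp_add, trajExp_const hA hΔ hK0, trajExp_sum]
    have hc0 : ∀ k, 0 ≤ c m k := fun k => blockLoss_nonneg hN hℓ _ k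
    have hcB : ∀ k, c m k ≤ B := fun k => blockLoss_le hN hB0 hℓ _ k
    have hterm : ∀ k, trajExp G W (mixing W) B A ℓ (fun a => η / 2 * (q a m k * c m k ^ 2) +
        γ / 2 * (q a m k ^ 2 * (y a m k - c m k) ^ 2)) ≤
        (η * B / 2 + 3 * γ / (4 * N)) *
          trajExp G W (mixing W) B A ℓ (fun a => q a m k * c m k) := by
      intro k
      rw [trajExp_add, trajExp_const_mul, trajExp_const_mul, add_mul]
      have e1 : trajExp G W (mixing W) B A ℓ (fun a => q a m k * c m k ^ 2) ≤
          B * trajExp G W (mixing W) B A ℓ (fun a => q a m k * c m k) := by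
        rw [← trajExp_const_mul]
        refine trajExp_mono hA hΔ hK0 hT0 fun a => ?_
        have := mul_le_mul_of_nonneg_left (hcB k) (mul_nonneg (hq0 a m k) (hc0 k))
        calc q a m k * c m k ^ 2 = q a m k * c m k * c m k := by ring
          _ ≤ _ := this
          _ = _ := by ring
      -- One factor `q` cancels `1/p` up to `3/2`, for every agent's `p`; summing the `N` agents
      -- against `1/N²` leaves `3/(2N)`.
      have e2 : trajExp G W (mixing W) B A ℓ
          (fun a => q a m k ^ 2 * (y a m k - c m k) ^ 2) ≤
          3 / (2 * N) * trajExp G W (mixing W) B A ℓ (fun a => q a m k * c m k) := by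
        refine (trajExp_meanEstimate_sq_le hA hΔ hK0 hT0 hℓ (copyBlock r m) k
          (H := fun a => q a m k ^ 2) (fun a b h => by simp only [hqpred m k a b h])
          (fun a => sq_nonneg _)).trans ?_
        rw [← trajExp_const_mul]
        refine trajExp_mono hA hΔ hK0 hT0 fun a => ?_
        have e3 : ∀ v : Fin T × Fin N, q a m k ^ 2 * (ℓ v.1 v.2 k /
            policy G W (mixing W) B A ℓ a (copyBlock r m) v.2 k) ≤
              3 / 2 * q a m k * ℓ v.1 v.2 k := by
          intro v
          have hp := policy_pos (G := G) (W := W) (κ := mixing W) (B := B) (ℓ := ℓ) hA hΔ hK0 hT0 a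
            (copyBlock r m) v.2 k
          have hpq := policy_ge_learnerOut hN hW hσ hK hT hBdef hB hη hη1 hγ hAdef hℓ a hr
            hm.le i v.2 k
          change 2 / 3 * q a m k ≤ _ at hpq
          rw [← mul_div_assoc, div_le_iff₀ hp]
          have := mul_le_mul_of_nonneg_left hpq
            (mul_nonneg (hq0 a m k) (hℓ v.1 v.2 k).1)
          nlinarith
        have e4 : ∑ v ∈ blockRounds T B (copyBlock r m) ×ˢ (Finset.univ : Finset (Fin N)),
            ℓ v.1 v.2 k = N * c m k := by
          simp only [hc]
          rw [blockLoss_eq]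
          have : (N : ℝ) ≠ 0 := by positivity
          field_simp
        calc q a m k ^ 2 * (1 / (N : ℝ) ^ 2 * ∑ v ∈ blockRounds T B (copyBlock r m) ×ˢ
                (Finset.univ : Finset (Fin N)),
              ℓ v.1 v.2 k / policy G W (mixing W) B A ℓ a (copyBlock r m) v.2 k)
            = 1 / (N : ℝ) ^ 2 * ∑ v ∈ blockRounds T B (copyBlock r m) ×ˢ
                (Finset.univ : Finset (Fin N)), q a m k ^ 2 *
              (ℓ v.1 v.2 k / policy G W (mixing W) B A ℓ a (copyBlock r m) v.2 k) := by
              rw [← Finset.mul_sum]; ring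
          _ ≤ 1 / (N : ℝ) ^ 2 * ∑ v ∈ blockRounds T B (copyBlock r m) ×ˢ
                (Finset.univ : Finset (Fin N)), 3 / 2 * q a m k * ℓ v.1 v.2 k :=
              mul_le_mul_of_nonneg_left (Finset.sum_le_sum fun v _ => e3 v) (by positivity)
          _ = 3 / (2 * N) * (q a m k * c m k) := by
              rw [← Finset.mul_sum, e4]
              field_simp
      have e5 := mul_le_mul_of_nonneg_left e1 (by positivity : 0 ≤ η / 2)
      have e6 := mul_le_mul_of_nonneg_left e2 (by positivity : 0 ≤ γ / 2)
      refine (add_le_add e5 e6).trans (le_of_eq ?_)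
      have : (N : ℝ) ≠ 0 := by positivity
      generalize trajExp G W (mixing W) B A ℓ (fun a => q a m k * c m k) = Z
      field_simp
      ring
    refine add_le_add ((Finset.sum_le_sum fun k _ => hterm k).trans (le_of_eq ?_)) le_rfl
    rw [← Finset.mul_sum, ← trajExp_sum, hV m]
  have h2 := Finset.sum_le_sum hright
  rw [Finset.sum_add_distrib, ← Finset.mul_sum, Finset.sum_const, Finset.card_range,
    nsmul_eq_mul] at h2
  have h3 : (T : ℝ) * (4 * (1 / ((K : ℝ) ^ 5 * T ^ 3))) = 4 * (1 / ((K : ℝ) ^ 5 * T ^ 2)) := by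
    field_simp
  have h4 : ∑ m ∈ Finset.range T, (V m - ∑ k, u k * c m k) =
      ∑ m ∈ Finset.range T, E (fun a => ∑ k, (q a m k - u k) * y a m k) :=
    Finset.sum_congr rfl fun m _ => (hleft m).symm
  rw [h4]
  rw [h3] at h2
  linarith

end Regret

/-! ### Regret of an agent for general learning rates -/

section RegretBound

variable {N K T : ℕ} {G : SimpleGraph (Fin N)} {W : Matrix (Fin N) (Fin N) ℝ}
  {ℓ : Fin T → Fin N → Fin K → ℝ}

theorem bestLoss_nonneg (hN : 0 < N) (hℓ : ∀ t i k, ℓ t i k ∈ Set.Icc (0 : ℝ) 1) :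
    0 ≤ bestLoss ℓ :=
  Real.iInf_nonneg fun k => Finset.sum_nonneg fun t _ => (avgLoss_mem hN hℓ t k).1

theorem sum_blockLoss_copyBlock {B : ℕ} (u : Fin K → ℝ) :
    ∑ r ∈ Finset.range 2, ∑ m ∈ Finset.range T, ∑ k, u k * blockLoss B ℓ (copyBlock r m) k =
      ∑ k, u k * ∑ t, avgLoss ℓ t k := by
  rw [Finset.sum_congr rfl fun r _ => Finset.sum_comm, Finset.sum_comm]
  refine Finset.sum_congr rfl fun k _ => ?_
  simp only [← Finset.mul_sum]
  rw [← sum_copyBlock (B := B)]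
  rfl

/-- A comparator in the interior of the simplex that is nearly as good as the best action. -/
theorem exists_smoothed_comparator (hN : 0 < N) (hK : 0 < K) (hT : 0 < T)
    (hℓ : ∀ t i k, ℓ t i k ∈ Set.Icc (0 : ℝ) 1) :
    ∃ u ∈ stdSimplex ℝ (Fin K), (∀ k, 1 / ((T : ℝ) * K) ≤ u k) ∧
      ∑ k, u k * ∑ t, avgLoss ℓ t k ≤ bestLoss ℓ + 1 := by
  have : Nonempty (Fin K) := ⟨⟨0, hK⟩⟩
  obtain ⟨k₀, hk₀⟩ := exists_eq_ciInf_of_finite (f := fun k : Fin K => ∑ t, avgLoss ℓ t k)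
  have h1 : 1 / (T : ℝ) ≤ 1 := by
    rw [div_le_one (by positivity)]; exact_mod_cast hT
  have hT' : (T : ℝ) ≠ 0 := by positivity
  have hK' : (K : ℝ) ≠ 0 := by positivity
  set u : Fin K → ℝ := fun k => (1 - 1 / (T : ℝ)) * (if k = k₀ then 1 else 0) + 1 / (T * K)
    with hu
  have hlow : ∀ k, 1 / ((T : ℝ) * K) ≤ u k := fun k => by
    have : 0 ≤ (1 - 1 / (T : ℝ)) * (if k = k₀ then 1 else 0) :=
      mul_nonneg (by linarith) (by split_ifs <;> norm_num)
    simp only [hu]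
    linarith
  refine ⟨u, ⟨fun k => le_trans (by positivity) (hlow k), ?_⟩, hlow, ?_⟩
  · simp only [hu, Finset.sum_add_distrib, ← Finset.mul_sum]
    simp
    field_simp
    ring
  · have h2 : ∀ k, ∑ t, avgLoss ℓ t k ≤ T := fun k => by
      calc ∑ t, avgLoss ℓ t k ≤ ∑ _t : Fin T, (1 : ℝ) :=
            Finset.sum_le_sum fun t _ => (avgLoss_mem hN hℓ t k).2
        _ = T := by simp
    have h3 : ∑ k, u k * ∑ t, avgLoss ℓ t k = (1 - 1 / (T : ℝ)) * bestLoss ℓ +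
        ∑ k, 1 / ((T : ℝ) * K) * ∑ t, avgLoss ℓ t k := by
      simp only [hu, add_mul, Finset.sum_add_distrib]
      congr 1
      rw [Finset.sum_eq_single k₀]
      · simp only [if_true, mul_one]
        rw [hk₀]; rfl
      · intro k _ hk
        simp [hk]
      · simp
    have h4 : ∑ k, 1 / ((T : ℝ) * K) * ∑ t, avgLoss ℓ t k ≤ 1 := by
      calc ∑ k, 1 / ((T : ℝ) * K) * ∑ t, avgLoss ℓ t k ≤ ∑ _k : Fin K, 1 / ((T : ℝ) * K) * T :=
            Finset.sum_le_sum fun k _ => mul_le_mul_of_nonneg_left (h2 k) (by positivity)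
        _ = 1 := by simp; field_simp
    have h5 := bestLoss_nonneg hN hℓ
    have h6 : 0 ≤ 1 / (T : ℝ) * bestLoss ℓ := by positivity
    rw [h3]
    linarith

/-- The expected loss of an agent is the expected loss of its base learner, up to the cost of the
uniform exploration. -/
theorem trajExp_loss_le (hN : 0 < N) (hK : 0 < K) (hT : 0 < T)
    (hℓ : ∀ t i k, ℓ t i k ∈ Set.Icc (0 : ℝ) 1) {κ : ℝ} {B : ℕ} {A : Learner K}
    (hA : IsCausal A) (hΔ : ∀ Z τ, A Z τ ∈ stdSimplex ℝ (Fin K)) (i : Fin N) :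
    trajExp G W κ B A ℓ (fun a => ∑ t, avgLoss ℓ t (a t i)) ≤
      ∑ r ∈ Finset.range 2, ∑ m ∈ Finset.range T, trajExp G W κ B A ℓ
        (fun a => ∑ k, learnerOut G W κ B A ℓ a (copyBlock r m) i k *
          blockLoss B ℓ (copyBlock r m) k) + 1 := by
  have hT' : (T : ℝ) ≠ 0 := by positivity
  have hK' : (K : ℝ) ≠ 0 := by positivity
  have h1 : ∀ t : Fin T, trajExp G W κ B A ℓ (fun a => avgLoss ℓ t (a t i)) ≤
      trajExp G W κ B A ℓ
        (fun a => ∑ k, learnerOut G W κ B A ℓ a (blockOf B t) i k * avgLoss ℓ t k) +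
        1 / (T : ℝ) := by
    intro t
    rw [trajExp_action hA hΔ hK t i, ← trajExp_const (G := G) (W := W) (κ := κ) (B := B)
      (A := A) (ℓ := ℓ) hA hΔ hK (1 / (T : ℝ)), ← trajExp_add]
    refine trajExp_mono hA hΔ hK hT fun a => ?_
    have h2 : ∑ _k : Fin K, 1 / (T : ℝ) * (1 / (K : ℝ)) = 1 / (T : ℝ) := by
      simp; field_simp
    rw [← h2, ← Finset.sum_add_distrib]
    refine Finset.sum_le_sum fun k _ => ?_
    rw [policy_eq hA, add_mul, sub_mul, sub_mul, one_mul]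
    have h3 := avgLoss_mem hN hℓ t k
    have h4 : 0 ≤ learnerOut G W κ B A ℓ a (blockOf B t) i k := (hΔ _ _).1 k
    have h5 : 0 ≤ 1 / (T : ℝ) * learnerOut G W κ B A ℓ a (blockOf B t) i k * avgLoss ℓ t k := by
      have := h3.1
      positivity
    have h6 : 1 / (T : ℝ) * (1 / (K : ℝ)) * avgLoss ℓ t k ≤ 1 / (T : ℝ) * (1 / (K : ℝ)) :=
      mul_le_of_le_one_right (by positivity) h3.2
    linarith
  rw [trajExp_sum]
  refine (Finset.sum_le_sum fun t _ => h1 t).trans ?_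
  rw [Finset.sum_add_distrib]
  have h2 : ∑ _t : Fin T, 1 / (T : ℝ) = 1 := by simp; field_simp
  rw [h2, ← sum_copyBlock (B := B)]
  refine add_le_add (le_of_eq ?_) le_rfl
  refine Finset.sum_congr rfl fun r _ => Finset.sum_congr rfl fun m _ => ?_
  rw [← trajExp_sum]
  congr 1
  funext a
  simp only [blockLoss, Finset.mul_sum]
  rw [Finset.sum_comm]
  refine Finset.sum_congr rfl fun k _ => Finset.sum_congr rfl fun t ht => ?_
  rw [mem_blockRounds.1 ht]

/-- The regret bound for general learning rates. -/
theorem agentRegret_le (hN : 0 < N) (hW : IsGossipMatrix G W)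
    (hσ : sigma2 W < 1) (hK : 2 ≤ K) (hT : 3 ≤ T)
    {B : ℕ} (hBdef : B = blockLength K T W) (hB0 : 0 < B) (hB : B ≤ T) {η γ : ℝ}
    (hη : 0 < η) (hη1 : η ≤ 1 / (4 * B)) (hγ : 0 < γ) (hγ1 : γ ≤ N / 12)
    (hℓ : ∀ t i k, ℓ t i k ∈ Set.Icc (0 : ℝ) 1) (i : Fin N)
    {A : Learner K} (hAdef : A = delayed (ftrl fun _ => hybridReg η γ)) :
    agentRegret G W (mixing W) B A ℓ i ≤ 4 + 3 * (Real.log K / η + K * Real.log T / γ) +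
      (η * B + 3 / 2 * (γ / N)) * bestLoss ℓ := by
  have hK0 : 0 < K := by omega
  have hT0 : 0 < T := by omega
  have hA : IsCausal A := hAdef ▸ isCausal_delayed_ftrl _
  have hΔ : ∀ Z τ, A Z τ ∈ stdSimplex ℝ (Fin K) := hAdef ▸ delayed_ftrl_mem hK0 hη hγ
  obtain ⟨u, hu, huT, hucost⟩ := exists_smoothed_comparator hN hK0 hT0 hℓ
  have hBr : (1 : ℝ) ≤ B := by exact_mod_cast hB0
  have hNr : (0 : ℝ) < N := by positivity
  have hη4 : η ≤ 1 / 4 := hη1.trans (by gcongr; linarith)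
  set V : ℕ → ℕ → ℝ := fun r m => trajExp G W (mixing W) B A ℓ
      (fun a => ∑ k, learnerOut G W (mixing W) B A ℓ a (copyBlock r m) i k *
        blockLoss B ℓ (copyBlock r m) k) with hV
  have h1 := trajExp_loss_le (G := G) (W := W) (κ := mixing W) (B := B) hN hK0 hT0 hℓ hA hΔ i
  have h2 : ∀ r < 2, _ := fun r hr =>
    copy_expected_regret_le hN hW hσ hK hT hBdef hB0 hB hη hη4 hγ hℓ hr i hu huT hAdef
      (V := V r) (fun _ => rfl)
  have h20 := h2 0 (by norm_num)
  have h21 := h2 1 (by norm_num)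
  have h3 := sum_blockLoss_copyBlock (B := B) (ℓ := ℓ) u
  change _ ≤ ∑ r ∈ Finset.range 2, ∑ m ∈ Finset.range T, V r m + 1 at h1
  simp only [Finset.sum_range_succ _ 1, Finset.sum_range_one] at h1 h3
  rw [Finset.sum_sub_distrib] at h20 h21
  have hreg : agentRegret G W (mixing W) B A ℓ i =
    trajExp G W (mixing W) B A ℓ (fun a => ∑ t, avgLoss ℓ t (a t i)) - bestLoss ℓ := rfl
  have hε : 4 * (1 / ((K : ℝ) ^ 5 * T ^ 2)) ≤ 1 / 2 := by
    have h5 : (2 : ℝ) ^ 5 * 3 ^ 2 ≤ (K : ℝ) ^ 5 * T ^ 2 := by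
      have : (2 : ℝ) ≤ K := by exact_mod_cast hK
      have : (3 : ℝ) ≤ T := by exact_mod_cast hT
      gcongr
    have h6 : 1 / ((K : ℝ) ^ 5 * T ^ 2) ≤ 1 / ((2 : ℝ) ^ 5 * 3 ^ 2) := by gcongr
    norm_num at h6 ⊢
    linarith
  have hL := bestLoss_nonneg hN hℓ
  set P := Real.log K / η + K * Real.log T / γ with hP
  have hP0 : 0 ≤ P := by
    have := Real.log_natCast_nonneg K
    have := Real.log_natCast_nonneg T
    positivity
  set α := η * B / 2 + 3 * γ / (4 * N) with hα
  have hα0 : 0 ≤ α := by positivity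
  have hα1 : α ≤ 3 / 16 := by
    have e1 : η * B ≤ 1 / 4 := by
      calc η * B ≤ 1 / (4 * B) * B := by gcongr
        _ = 1 / 4 := by field_simp
    have e2 : 3 * γ / (4 * N) ≤ 1 / 16 := by
      rw [div_le_iff₀ (by positivity)]
      linarith
    linarith
  have hα2 : η * B + 3 / 2 * (γ / N) = 2 * α := by
    rw [hα]; field_simp; ring
  rw [hreg, hα2]
  set v := ∑ m ∈ Finset.range T, V 0 m + ∑ m ∈ Finset.range T, V 1 m with hv
  -- Both copies are added. The `2` is one unit for smoothing the comparator and two gossip errors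
  -- of at most `1/2`; the stability terms are `α v` and move to the left.
  have h4 : v * (1 - α) ≤ bestLoss ℓ + 2 + 2 * P := by
    have : α * v = α * ∑ m ∈ Finset.range T, V 0 m + α * ∑ m ∈ Finset.range T, V 1 m := by
      rw [hv]; ring
    linarith
  -- Dividing by `1 - α`: for `α ≤ 3/16` one has `1 ≤ (1 + 2 α)(1 - α)` and `2 ≤ 3 (1 - α)`.
  have h5 : v ≤ bestLoss ℓ + 3 + 3 * P + 2 * α * bestLoss ℓ := by
    by_contra! hcon
    have h6 : (bestLoss ℓ + 3 + 3 * P + 2 * α * bestLoss ℓ) * (1 - α) < v * (1 - α) :=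
      mul_lt_mul_of_pos_right hcon (by linarith)
    have h7 : 0 ≤ α * bestLoss ℓ := by positivity
    have h8 : α * (α * bestLoss ℓ) ≤ 3 / 16 * (α * bestLoss ℓ) := by gcongr
    have h9 : α * P ≤ 3 / 16 * P := by gcongr
    nlinarith
  linarith

theorem agentRegret_le_horizon (hN : 0 < N) (hK : 0 < K) (hT : 0 < T)
    (hℓ : ∀ t i k, ℓ t i k ∈ Set.Icc (0 : ℝ) 1) {κ : ℝ} {B : ℕ} {A : Learner K}
    (hA : IsCausal A) (hΔ : ∀ Z τ, A Z τ ∈ stdSimplex ℝ (Fin K)) (i : Fin N) :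
    agentRegret G W κ B A ℓ i ≤ T := by
  have hL := bestLoss_nonneg hN hℓ
  have h1 : trajExp G W κ B A ℓ (fun a => ∑ t, avgLoss ℓ t (a t i)) ≤
      trajExp G W κ B A ℓ (fun _ => (T : ℝ)) := by
    refine trajExp_mono hA hΔ hK hT fun a => ?_
    calc ∑ t, avgLoss ℓ t (a t i) ≤ ∑ _t : Fin T, (1 : ℝ) :=
          Finset.sum_le_sum fun t _ => (avgLoss_mem hN hℓ t _).2
      _ = T := by simp
  rw [trajExp_const hA hΔ hK] at h1
  have h2 : agentRegret G W κ B A ℓ i =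
    trajExp G W κ B A ℓ (fun a => ∑ t, avgLoss ℓ t (a t i)) - bestLoss ℓ := rfl
  linarith

end RegretBound

/-! ### The tuning -/

section Tuning

/-- The unconstrained choice `√(x/y)` balances `x/m` against `m y`, both then being `√(x y)`; the
cap `a` adds only `x/a` to the first. -/
theorem min_sqrt_tuning {a x y : ℝ} (ha : 0 < a) (hx : 0 < x) (hy : 0 < y) :
    x / min a √(x / y) ≤ x / a + √(y * x) ∧ min a √(x / y) * y ≤ √(y * x) := by
  have hxy : 0 < √(x / y) := by positivity
  have e1 : √(x / y) * y = √(y * x) := by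
    have h : √(y * x) = √(y ^ 2 * (x / y)) := by
      congr 1
      field_simp
    rw [h, Real.sqrt_mul (sq_nonneg y), Real.sqrt_sq hy.le, mul_comm]
  have e2 : x / √(x / y) = √(y * x) := by
    rw [div_eq_iff hxy.ne', ← e1, mul_right_comm, Real.mul_self_sqrt (by positivity)]
    field_simp
  constructor
  · rcases min_choice a √(x / y) with h | h <;> rw [h]
    · linarith [Real.sqrt_nonneg (y * x)]
    · rw [e2]
      have : 0 < x / a := by positivity
      linarith
  · rw [← e1]
    exact mul_le_mul_of_nonneg_right (min_le_right _ _) hy.le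

theorem etaSL_spec {K B : ℕ} (hK : 2 ≤ K) (hB : 0 < B) {L : ℝ} (hL : 0 ≤ L) :
    0 < etaSL K B L ∧ etaSL K B L ≤ 1 / (4 * B) ∧
      Real.log K / etaSL K B L ≤ 4 * (B * Real.log K) + √(B * L * Real.log K) ∧
      etaSL K B L * B * L ≤ √(B * L * Real.log K) := by
  have hlog : 0 < Real.log K := Real.log_pos (by exact_mod_cast hK)
  have hBr : (0 : ℝ) < B := by positivity
  unfold etaSL
  split_ifs with h
  · refine ⟨by positivity, le_rfl, ?_, by simp [h]⟩
    rw [h]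
    simp only [mul_zero, zero_mul, Real.sqrt_zero, add_zero]
    apply le_of_eq; field_simp
  · have hL' : 0 < L := lt_of_le_of_ne hL (Ne.symm h)
    obtain ⟨h1, h2⟩ := min_sqrt_tuning (a := 1 / (4 * (B : ℝ))) (by positivity) hlog
      (mul_pos hBr hL')
    refine ⟨lt_min (by positivity) (by positivity), min_le_left _ _, h1.trans (le_of_eq ?_), ?_⟩
    · field_simp
    · rw [mul_assoc]; exact h2

theorem gammaSL_spec {N K T : ℕ} (hN : 0 < N) (hK : 2 ≤ K) (hT : 3 ≤ T) {L : ℝ} (hL : 0 ≤ L) :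
    0 < gammaSL N K T L ∧ gammaSL N K T L ≤ N / 12 ∧
      K * Real.log T / gammaSL N K T L ≤ 12 * (K * Real.log T / N) + √(K * L * Real.log T / N) ∧
      gammaSL N K T L / N * L ≤ √(K * L * Real.log T / N) := by
  have hT1 : (1 : ℝ) < T := by exact_mod_cast (by omega : 1 < T)
  have hlog : 0 < Real.log T := Real.log_pos hT1
  have hNr : (0 : ℝ) < N := by positivity
  have hKr : (0 : ℝ) < K := by positivity
  unfold gammaSL
  split_ifs with h
  · refine ⟨by positivity, le_rfl, ?_, by simp [h]⟩
    rw [h]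
    simp only [mul_zero, zero_mul, zero_div, Real.sqrt_zero, add_zero]
    apply le_of_eq; field_simp
  · have hL' : 0 < L := lt_of_le_of_ne hL (Ne.symm h)
    have hx : 0 < K * Real.log T / N := by positivity
    obtain ⟨h1, h2⟩ := min_sqrt_tuning (a := 1 / 12) (by positivity) hx hL'
    -- In units of `N` the tuning of `γ` is the scalar problem with cap `1/12` and penalty `K log T
    -- / N`.
    have e : min ((N : ℝ) / 12) √((K : ℝ) * N * Real.log T / L) =
        N * min (1 / 12) √(K * Real.log T / N / L) := by
      rw [mul_min_of_nonneg _ _ hNr.le]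
      congr 1
      · ring
      · rw [← Real.sqrt_sq hNr.le, ← Real.sqrt_mul (by positivity), Real.sqrt_sq hNr.le]
        congr 1
        field_simp
    have e2 : L * (K * Real.log T / N) = K * L * Real.log T / N := by ring
    rw [e2] at h1 h2
    have hm : 0 < min (1 / 12) √(K * Real.log T / N / L) :=
      lt_min (by positivity) (by positivity)
    refine ⟨lt_min (by positivity) (by positivity), min_le_left _ _, ?_, ?_⟩
    · rw [e, ← div_div]
      refine h1.trans (le_of_eq ?_)
      ring
    · rw [e, mul_div_cancel_left₀ _ hNr.ne']; exact h2

theorem half_le_log_natCast {K : ℕ} (hK : 2 ≤ K) : 1 / 2 ≤ Real.log K := by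
  have h1 : Real.log 2 ≤ Real.log K :=
    Real.log_le_log (by norm_num) (by exact_mod_cast hK)
  linarith [Real.log_two_gt_d9]

theorem blockLength_pos {N K T : ℕ} (hN : 0 < N) (hK : 2 ≤ K) (hT : 3 ≤ T)
    {W : Matrix (Fin N) (Fin N) ℝ} (hσ : sigma2 W < 1) : 0 < blockLength K T W := by
  by_contra h0
  have h1 := blockLength_mul_ge (W := W) K T hσ
  rw [Nat.eq_zero_of_not_pos h0] at h1
  have hK2 : (2 : ℝ) ≤ K := by exact_mod_cast hK
  have hT3 : (3 : ℝ) ≤ T := by exact_mod_cast hT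
  have hN1 : (1 : ℝ) ≤ N := by exact_mod_cast hN
  have h2 : (1 : ℝ) < ((K : ℝ) * T) ^ 6 * √(14 * N) := by
    have e1 : (1 : ℝ) < ((K : ℝ) * T) ^ 6 := one_lt_pow₀ (by nlinarith) (by norm_num)
    have e2 : 1 ≤ √(14 * (N : ℝ)) := Real.one_le_sqrt.2 (by linarith)
    nlinarith
  have := Real.log_pos h2
  rw [Nat.cast_zero, zero_mul] at h1
  linarith

theorem regret_smallLossLearner_le {N K T : ℕ} (hN : 0 < N) (hK : 2 ≤ K) (hT : 3 ≤ T)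
    {G : SimpleGraph (Fin N)} {W : Matrix (Fin N) (Fin N) ℝ} (hW : IsGossipMatrix G W)
    (hσ : sigma2 W < 1) {ℓ : Fin T → Fin N → Fin K → ℝ}
    (hℓ : ∀ t i k, ℓ t i k ∈ Set.Icc (0 : ℝ) 1) {B : ℕ} (hBdef : B = blockLength K T W) {L : ℝ}
    (hL : L = bestLoss ℓ) :
    regret G W (mixing W) B (smallLossLearner N K T B L) ℓ ≤
      40 * (√(B * L * Real.log K) + √(K * L * Real.log T / N)
          + B * Real.log K + K * Real.log T / N) := by
  have hK0 : 0 < K := by omega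
  have hT0 : 0 < T := by omega
  have hB0 : 0 < B := hBdef ▸ blockLength_pos hN hK hT hσ
  have hBr : (1 : ℝ) ≤ B := by exact_mod_cast hB0
  have hL0 : 0 ≤ L := hL ▸ bestLoss_nonneg hN hℓ
  have hlogK := half_le_log_natCast hK
  have hBlog : (B : ℝ) ≤ 2 * (B * Real.log K) := by nlinarith
  have hlogT : 0 ≤ K * Real.log T / N := by
    have := Real.log_natCast_nonneg T
    positivity
  have hs1 := Real.sqrt_nonneg (B * L * Real.log K)
  have hs2 := Real.sqrt_nonneg (K * L * Real.log T / N)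
  obtain ⟨η0, η1, η2, η3⟩ := etaSL_spec (L := L) hK hB0 hL0
  obtain ⟨γ0, γ1, γ2, γ3⟩ := gammaSL_spec (N := N) (T := T) (L := L) hN hK hT hL0
  have : Nonempty (Fin N) := ⟨⟨0, hN⟩⟩
  refine ciSup_le fun i => ?_
  rcases le_or_gt B T with hBT | hBT
  · have h1 := agentRegret_le hN hW hσ hK hT hBdef hB0 hBT η0 η1 γ0 γ1 hℓ i
      (A := smallLossLearner N K T B L) rfl
    rw [← hL] at h1
    linarith
  -- With less than one full block the trivial bound suffices: `T < B ≤ 2 B log K`, because `log K ≥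
  -- 1/2`.
  · have h1 := agentRegret_le_horizon (G := G) (W := W) (κ := mixing W) (B := B)
      (A := smallLossLearner N K T B L) hN hK0 hT0 hℓ (isCausal_delayed_ftrl _)
      (delayed_ftrl_mem hK0 η0 γ0) i
    have : (T : ℝ) ≤ B := by exact_mod_cast hBT.le
    linarith

/-- The logarithm in `B` is at most `15/2` times `log (KNT)`, and `1 - 1/√2 ≥ 1/4` turns this into
`30`; rounding up costs one more. -/
theorem blockLength_le {N K T : ℕ} (hN : 0 < N) (hK : 2 ≤ K) (hT : 3 ≤ T)
    {W : Matrix (Fin N) (Fin N) ℝ} (hσ : sigma2 W < 1) :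
    (blockLength K T W : ℝ) ≤
      31 * Real.log ((K : ℝ) * N * T) * spectralGap W ^ (-(1 / 2) : ℝ) := by
  have hK2 : (2 : ℝ) ≤ K := by exact_mod_cast hK
  have hT3 : (3 : ℝ) ≤ T := by exact_mod_cast hT
  have hN1 : (1 : ℝ) ≤ N := by exact_mod_cast hN
  have hρ0 : 0 < spectralGap W := by unfold spectralGap; linarith
  have hρ1 : spectralGap W ≤ 1 := by unfold spectralGap; linarith [sigma2_nonneg W]
  set Λ := Real.log ((K : ℝ) * N * T) with hΛ
  have hΛe : Λ = Real.log K + Real.log N + Real.log T := by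
    rw [hΛ, Real.log_mul (by positivity) (by positivity),
      Real.log_mul (by positivity) (by positivity)]
  have hlogN := Real.log_natCast_nonneg N
  have h6 : Real.log 6 ≤ Λ := Real.log_le_log (by norm_num) (by
    calc (6 : ℝ) = 2 * 1 * 3 := by norm_num
      _ ≤ K * N * T := by gcongr)
  have h14 : Real.log 14 ≤ 2 * Real.log 6 := by
    rw [show (2 : ℝ) = ((2 : ℕ) : ℝ) by norm_num, ← Real.log_pow]
    exact Real.log_le_log (by norm_num) (by norm_num)
  have h1 : 1 ≤ Real.log 6 := by
    have : Real.log 6 = Real.log 2 + Real.log 3 := by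
      rw [← Real.log_mul (by norm_num) (by norm_num)]; norm_num
    have h32 : Real.log 2 ≤ Real.log 3 := Real.log_le_log (by norm_num) (by norm_num)
    linarith [Real.log_two_gt_d9]
  have hR : spectralGap W ^ (-(1 / 2) : ℝ) = 1 / √(spectralGap W) := by
    rw [Real.rpow_neg hρ0.le, ← Real.sqrt_eq_rpow, one_div]
  have hs0 : 0 < √(spectralGap W) := Real.sqrt_pos.2 hρ0
  have hR1 : 1 ≤ 1 / √(spectralGap W) := by
    rw [le_div_iff₀ hs0, one_mul]; exact Real.sqrt_le_one.2 hρ1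
  have hX : Real.log (((K : ℝ) * T) ^ 6 * √(14 * N)) ≤ 15 / 2 * Λ := by
    rw [Real.log_mul (by positivity) (by positivity), Real.log_pow,
      Real.log_mul (by positivity) (by positivity), Real.log_sqrt (by positivity),
      Real.log_mul (by positivity) (by positivity)]
    push_cast
    linarith
  have hX0 : 0 ≤ 15 / 2 * Λ := by linarith
  have hc : 1 / 4 ≤ 1 - 1 / √2 := by
    have : 1 / √2 ≤ 3 / 4 := by
      rw [div_le_iff₀ (by positivity)]
      have : 4 / 3 ≤ √2 := Real.le_sqrt_of_sq_le (by norm_num)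
      linarith
    linarith
  have hceil : (blockLength K T W : ℝ) ≤
      Real.log (((K : ℝ) * T) ^ 6 * √(14 * N)) / ((1 - 1 / √2) * √(1 - sigma2 W)) + 1 := by
    refine (Nat.ceil_lt_add_one (div_nonneg (Real.log_nonneg ?_) ?_)).le
    · have e1 : (1 : ℝ) ≤ ((K : ℝ) * T) ^ 6 := one_le_pow₀ (by nlinarith)
      have e2 : 1 ≤ √(14 * (N : ℝ)) := Real.one_le_sqrt.2 (by linarith)
      nlinarith
    · have : 0 ≤ 1 - 1 / √2 := by linarith
      positivity
  rw [hR]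
  refine hceil.trans ?_
  change _ / (_ * √(spectralGap W)) + 1 ≤ _
  have h2 : Real.log (((K : ℝ) * T) ^ 6 * √(14 * N)) / ((1 - 1 / √2) * √(spectralGap W)) ≤
      15 / 2 * Λ / (1 / 4 * √(spectralGap W)) := by gcongr
  have h3 : 15 / 2 * Λ / (1 / 4 * √(spectralGap W)) = 30 * Λ * (1 / √(spectralGap W)) := by
    field_simp; ring
  have h4 : 1 ≤ Λ * (1 / √(spectralGap W)) := by nlinarith
  rw [h3] at h2
  linarith

/-- One logarithm comes from `B` and one from `log K`, hence the exponent two. Under the roots,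
factors at least one may be enlarged to their squares before being pulled out. -/
theorem bound_le_log_mul {N K T : ℕ} (hN : 0 < N) (hK : 2 ≤ K) (hT : 3 ≤ T) {B R L : ℝ}
    (hR : 0 ≤ R) (hL : 0 ≤ L)
    (hB : B ≤ 31 * Real.log ((K : ℝ) * N * T) * R) :
    √(B * L * Real.log K) + √(K * L * Real.log T / N) + B * Real.log K + K * Real.log T / N ≤
      31 * Real.log ((K : ℝ) * N * T) ^ 2 * (√(R * L) + √(K * L / N) + R + K / N) := by
  have hK2 : (2 : ℝ) ≤ K := by exact_mod_cast hK
  have hT3 : (3 : ℝ) ≤ T := by exact_mod_cast hT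
  have hN1 : (1 : ℝ) ≤ N := by exact_mod_cast hN
  set Λ := Real.log ((K : ℝ) * N * T) with hΛ
  have hΛe : Λ = Real.log K + Real.log N + Real.log T := by
    rw [hΛ, Real.log_mul (by positivity) (by positivity),
      Real.log_mul (by positivity) (by positivity)]
  have hlogN := Real.log_natCast_nonneg N
  have hlogK := half_le_log_natCast hK
  have hlogT : 1 / 2 ≤ Real.log T := half_le_log_natCast (by omega)
  have hΛ1 : 1 ≤ Λ := by linarith
  have hKΛ : Real.log K ≤ Λ := by linarith
  have hTΛ : Real.log T ≤ Λ := by linarith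
  have hΛ2 : Λ ≤ Λ ^ 2 := by nlinarith
  have hKN : 0 ≤ (K : ℝ) / N := by positivity
  have e1 : √(B * L * Real.log K) ≤ 31 * Λ ^ 2 * √(R * L) := by
    rw [show 31 * Λ ^ 2 * √(R * L) = √((31 * Λ ^ 2) ^ 2 * (R * L)) by
      rw [Real.sqrt_mul (sq_nonneg (31 * Λ ^ 2)), Real.sqrt_sq (by positivity)]]
    apply Real.sqrt_le_sqrt
    calc B * L * Real.log K ≤ 31 * Λ * R * L * Λ := by gcongr
      _ = 31 * Λ ^ 2 * (R * L) := by ring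
      _ ≤ (31 * Λ ^ 2) ^ 2 * (R * L) := by
        gcongr
        nlinarith
  have e2 : √(K * L * Real.log T / N) ≤ 31 * Λ ^ 2 * √(K * L / N) := by
    rw [show 31 * Λ ^ 2 * √(K * L / N) = √((31 * Λ ^ 2) ^ 2 * (K * L / N)) by
      rw [Real.sqrt_mul (sq_nonneg (31 * Λ ^ 2)), Real.sqrt_sq (by positivity)]]
    apply Real.sqrt_le_sqrt
    calc K * L * Real.log T / N ≤ K * L * Λ / N := by gcongr
      _ = Λ * (K * L / N) := by ring
      _ ≤ (31 * Λ ^ 2) ^ 2 * (K * L / N) := by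
        gcongr
        nlinarith
  have e3 : B * Real.log K ≤ 31 * Λ ^ 2 * R := by
    calc B * Real.log K ≤ 31 * Λ * R * Λ := by gcongr
      _ = 31 * Λ ^ 2 * R := by ring
  have e4 : K * Real.log T / N ≤ 31 * Λ ^ 2 * (K / N) := by
    calc K * Real.log T / N = Real.log T * (K / N) := by ring
      _ ≤ 31 * Λ ^ 2 * (K / N) := by
        gcongr
        nlinarith
  linarith

end Tuning

end DistBandit

end

theorem mainTheorem3 :
    ∃ (C C' : ℝ) (m : ℕ), 0 < C ∧ 0 < C' ∧
      ∀ (N K T : ℕ), 2 ≤ K → 3 ≤ T →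
      ∀ (G : SimpleGraph (Fin N)), G.Connected →
      ∀ (W : Matrix (Fin N) (Fin N) ℝ), DistBandit.IsGossipMatrix G W →
        DistBandit.sigma2 W < 1 →
      ∀ (ℓ : Fin T → Fin N → Fin K → ℝ), (∀ t i k, ℓ t i k ∈ Set.Icc (0 : ℝ) 1) →
        let B : ℕ := DistBandit.blockLength K T W
        let κ : ℝ := DistBandit.mixing W
        let ρ : ℝ := DistBandit.spectralGap W
        let L : ℝ := DistBandit.bestLoss ℓ
        let bound : ℝ := √(B * L * Real.log K) + √(K * L * Real.log T / N)
          + B * Real.log K + K * Real.log T / N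
        DistBandit.regret G W κ B (DistBandit.smallLossLearner N K T B L) ℓ ≤ C * bound ∧
        bound ≤ C' * Real.log ((K : ℝ) * N * T) ^ m *
          (√(ρ ^ (-(1 / 2) : ℝ) * L) + √(K * L / N) + ρ ^ (-(1 / 2) : ℝ) + K / N) := by
  refine ⟨40, 31, 2, by norm_num, by norm_num, ?_⟩
  intro N K T hK hT G hG W hW hσ ℓ hℓ B κ ρ L bound
  have hN : 0 < N := Fin.pos_iff_nonempty.2 hG.nonempty
  refine ⟨DistBandit.regret_smallLossLearner_le hN hK hT hW hσ hℓ rfl rfl, ?_⟩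
  have hρ : 0 < DistBandit.spectralGap W := by unfold DistBandit.spectralGap; linarith
  exact DistBandit.bound_le_log_mul hN hK hT (Real.rpow_nonneg hρ.le _)
    (DistBandit.bestLoss_nonneg hN hℓ) (DistBandit.blockLength_le hN hK hT hσ)
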